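/- Let $F:\{1,2,\dots\}\to(0,\infty)$ satisfy $\sum_{k=1}^\infty 1/F(k)<\infty$. Let $(\tau(k))_{k\ge1}$ be independent random variables such that $\tau(k)$ is exponentially distributed with parameter $F(k)$, and fix an initial state $n_0\in\{1,2,\dots\}$. Let $$\Xi(t)=\min\Big\{k\in\{1,2,\dots\}:\ \sum_{l=n_0}^{k}\tau(l)>t\Big\}\qquad(t\ge0,\ \min\emptyset=\infty)$$ be the birth process with rates $F$ and $\Xi(0)=n_0$, and let $T=\sum_{k=n_0}^\infty\tau(k)$ be its explosion time. Then $T<\infty$ almost surely, and $T$ has a continuous density $g$, with $g(t)>0$ for all $t>0$. Moreover: 1. For every $t>0$, $$\mathbb P(\Xi(t)=x)\sim\frac{g(t)}{F(x)}\qquad\text{as }x\to\infty,$$ that is, the ratio of the two sides tends to $1$; and for every $t_0>0$ this convergence of the ratio is uniform in $t>t_0$. 2. For every $t>0$ we have $\mathbb P(T>t)>0$, the function $s\mapsto\log\mathbb P(T>s)$ is differentiable at $t$ with $-\frac{d}{dt}\log\mathbb P(T>t)=\frac{g(t)}{\mathbb P(T>t)}$, and $$\mathbb P(\Xi(t)>x\mid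 T>t)\sim\frac{g(t)}{\mathbb P(T>t)}\sum_{k=x+1}^\infty\frac1{F(k)}\qquad\text{as }x\to\infty .$$ -/

import Mathlib

open MeasureTheory ProbabilityTheory Filter Topology
open scoped ENNReal

noncomputable section

/-- The first passage time `T(k) = ∑_{l = n₀}^k τ(l)`: the time at which the process started in
`n₀` with sojourn times `τ` leaves the state `k` (an empty sum if `k < n₀`). -/
def passageTime {Ω : Type*} (τ : ℕ+ → Ω → ℝ) (n₀ k : ℕ+) (ω : Ω) : ℝ :=
  ∑ l ∈ Finset.Icc n₀ k, τ l ω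

open Classical in
/-- The birth process with sojourn times `τ` started in `n₀`:
`Ξ(t) = min {k : ∑_{l = n₀}^k τ(l) > t}`, where the minimum of the empty set is `∞`. -/
def birthProcess {Ω : Type*} (τ : ℕ+ → Ω → ℝ) (n₀ : ℕ+) (t : ℝ) (ω : Ω) : WithTop ℕ+ :=
  if h : ∃ k : ℕ+, t < passageTime τ n₀ k ω then ((PNat.find h : ℕ+) : WithTop ℕ+) else ⊤

/-- The explosion time `T = ∑_{k ≥ n₀} τ(k) ∈ [0, ∞]`. -/
def explosionTime {Ω : Type*} (τ : ℕ+ → Ω → ℝ) (n₀ : ℕ+) (ω : Ω) : ℝ≥0∞ :=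
  ∑' k : Set.Ici n₀, ENNReal.ofReal (τ k ω)

/-- The event `T > t` that the process has not exploded by time `t ≥ 0`. -/
def nonExplosion {Ω : Type*} (τ : ℕ+ → Ω → ℝ) (n₀ : ℕ+) (t : ℝ) : Set Ω :=
  {ω | ENNReal.ofReal t < explosionTime τ n₀ ω}

/-- `g` is the continuous probability density of the `[0, ∞]`-valued random variable `T`, which is
thereby almost surely finite. A density is only determined almost everywhere; its continuous
version is unique, and it is the one whose values at single points are meant. -/
structure IsContinuousDensity {Ω : Type*} [MeasurableSpace Ω] (T : Ω → ℝ≥0∞) (P : Measure Ω)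
    (g : ℝ → ℝ) : Prop where
  continuous : Continuous g
  nonneg : ∀ t, 0 ≤ g t
  ae_ne_top : ∀ᵐ ω ∂P, T ω ≠ ⊤
  hasLaw : HasLaw (fun ω => (T ω).toReal) (volume.withDensity fun t => ENNReal.ofReal (g t)) P

end

/-! Write `A n` for the partial sums of the sojourn times, reindexed to start at `n₀`, and `f n` for
`jumpDensity`. An exponential density is its rate times its survival function, so `f n = r n * P(A n
≤ t < A (n + 1))` is the density of `A (n + 1)`. The state probabilities are thus `f n / r n`, and
part 1 says that the densities of the partial sums converge to the density `g` of the total with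
uniformly small relative error on `[t₀, ∞)`.

The relative form needs comparisons valid up to `t = ∞`. The forward equation `f (n+1)' = r (n+1) *
(f n - f (n+1))` gives two kinds of bound, which feed each other in an induction: at most
exponential growth of `f n` on `[t₀, ∞)`, and `f n ≤ C * f (n+1)` there (`growth_bound_of_le_mul`,
`le_mul_of_growth_bound`).

Since the rates tend to infinity, there are arbitrarily large indices `N` with `μ = r N` strictly
below all later rates. Conditioning on the later sojourn times, with partial sums `A' m` and total
`T'`, gives `f (N + m) t = E f N (t - A' m)` and `g t = E f N (t - T')`. Monotonicity of `exp (μ t)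
* f N t` and the comparisons bound the difference by `f N t * E[exp (μ T') * min 1 (C (T' - A' m))]`
(`abs_jumpDensity_sub_totalDensity_le`). The variable `exp (μ T')` is integrable by the choice of
`N`, so the expectation tends to `0` by dominated convergence, uniformly in `t`. As `g ≥ c * f N` on
`[t₀, ∞)` (`exists_le_totalDensity`), the error is small relative to `g`. Part 2 follows by summing
part 1 over the states above `x`. -/

/-- The partial sums `∑_{i < n} Y i` of a sequence of random variables. -/
noncomputable def arrival {Ω : Type*} (Y : ℕ → Ω → ℝ) (n : ℕ) (ω : Ω) : ℝ :=
  ∑ i ∈ Finset.range n, Y i ω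

/-- The sum `∑_i Y i` of a sequence of random variables. -/
noncomputable def total {Ω : Type*} (Y : ℕ → Ω → ℝ) (ω : Ω) : ℝ := ∑' i, Y i ω

/-- A sequence of independent exponential random variables with summable means, which is
nonnegative and summable everywhere. -/
structure IsExpSeq {Ω : Type*} [MeasurableSpace Ω] (P : Measure Ω) (r : ℕ → ℝ)
    (Y : ℕ → Ω → ℝ) : Prop where
  measurable : ∀ n, Measurable (Y n)
  nonneg : ∀ n ω, 0 ≤ Y n ω
  summable : ∀ ω, Summable fun n => Y n ω
  indep : iIndepFun Y P
  law : ∀ n, HasLaw (Y n) (expMeasure (r n)) P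
  rate_pos : ∀ n, 0 < r n
  rate_summable : Summable fun n => 1 / r n

/-! ### Densities of sums and derivatives of distribution functions -/

section Density

variable {Ω : Type*} [MeasurableSpace Ω] {P : Measure Ω}

/-- Only one summand needs a density; this lets the remainder of the series enter as an arbitrary
law. -/
lemma hasLaw_add_of_density [IsProbabilityMeasure P] {A D : Ω → ℝ}
    {a : ℝ → ℝ≥0∞} (ha : Measurable a)
    (hA : HasLaw A (volume.withDensity a) P) (hD : Measurable D) (hind : IndepFun A D P) :
    HasLaw (fun ω => A ω + D ω) (volume.withDensity fun t => ∫⁻ ω, a (t - D ω) ∂P) P := by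
  have hDl : HasLaw D (P.map D) P := ⟨hD.aemeasurable, rfl⟩
  have : IsProbabilityMeasure (P.map D) := Measure.isProbabilityMeasure_map hD.aemeasurable
  have : IsProbabilityMeasure (volume.withDensity a) := by
    rw [← hA.map_eq]; exact Measure.isProbabilityMeasure_map hA.aemeasurable
  have h := IndepFun.hasLaw_fun_add hA hDl hind
  convert h using 1
  ext s hs
  have hm : Measurable fun p : ℝ × ℝ => a (p.1 - p.2) := by fun_prop
  have hmap : ∀ t, ∫⁻ ω, a (t - D ω) ∂P = ∫⁻ y, a (t - y) ∂(P.map D) := fun t => by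
    rw [lintegral_map (by fun_prop) hD]
  simp_rw [hmap]
  rw [withDensity_apply _ hs, ← lintegral_indicator_one hs,
    Measure.lintegral_conv (measurable_one.indicator hs),
    lintegral_withDensity_eq_lintegral_mul _ ha
      (Measurable.lintegral_prod_right' (f := fun p : ℝ × ℝ =>
        s.indicator (1 : ℝ → ℝ≥0∞) (p.1 + p.2)) ((measurable_one.indicator hs).comp (by fun_prop))),
    ← lintegral_indicator hs]
  have e1 : ∀ t, s.indicator (fun t => ∫⁻ y, a (t - y) ∂(P.map D)) t =
      ∫⁻ y, s.indicator 1 t * a (t - y) ∂(P.map D) := by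
    intro t
    by_cases h : t ∈ s <;> simp [h]
  have hs1 : Measurable (s.indicator (1 : ℝ → ℝ≥0∞)) := measurable_one.indicator hs
  simp_rw [e1]
  have e2 : ∀ x, (a * fun x => ∫⁻ y, s.indicator (1 : ℝ → ℝ≥0∞) (x + y) ∂(P.map D)) x =
      ∫⁻ y, a x * s.indicator (1 : ℝ → ℝ≥0∞) (x + y) ∂(P.map D) := by
    intro x
    simp only [Pi.mul_apply]
    rw [lintegral_const_mul _ (by fun_prop)]
  simp_rw [e2]
  refine (lintegral_lintegral_swap (by fun_prop)).trans
    (Eq.trans ?_ (lintegral_lintegral_swap (by fun_prop)).symm)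
  refine lintegral_congr fun y => ?_
  -- Translation invariance of Lebesgue measure turns `a (t - y)` into `a x` with `t = x + y`.
  rw [← lintegral_add_right_eq_self (μ := volume) _ y]
  simp [mul_comm]

lemma hasLaw_add_of_real_density [IsProbabilityMeasure P] {A D : Ω → ℝ}
    {a : ℝ → ℝ} {K : ℝ} (ha : Measurable a)
    (h0 : ∀ t, 0 ≤ a t) (hK : ∀ t, a t ≤ K)
    (hA : HasLaw A (volume.withDensity fun t => ENNReal.ofReal (a t)) P) (hD : Measurable D)
    (hind : IndepFun A D P) :
    HasLaw (fun ω => A ω + D ω)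
      (volume.withDensity fun t => ENNReal.ofReal (∫ ω, a (t - D ω) ∂P)) P := by
  convert hasLaw_add_of_density (by fun_prop) hA hD hind using 3 with t
  refine ofReal_integral_eq_lintegral_ofReal ?_ (ae_of_all _ fun ω => h0 _)
  refine Integrable.of_bound (C := K) (ha.comp (by fun_prop)).aestronglyMeasurable
    (ae_of_all _ fun ω => ?_)
  rw [Real.norm_of_nonneg (h0 _)]; exact hK _

lemma continuous_integral_comp_sub [IsProbabilityMeasure P] {D : Ω → ℝ}
    {a : ℝ → ℝ} {K : ℝ} (ha : Continuous a)
    (h0 : ∀ t, 0 ≤ a t) (hK : ∀ t, a t ≤ K) (hD : Measurable D) :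
    Continuous fun t => ∫ ω, a (t - D ω) ∂P := by
  have := ha.measurable
  refine continuous_of_dominated (bound := fun _ => K) (fun t => by fun_prop)
    (fun t => ae_of_all _ fun ω => ?_) (by simp) (ae_of_all _ fun ω => by fun_prop)
  rw [Real.norm_of_nonneg (h0 _)]; exact hK _

/-- Densities of one law agree almost everywhere, hence everywhere when continuous. This turns
equalities of laws into pointwise convolution identities. -/
lemma eq_of_hasLaw_withDensity {A B : Ω → ℝ} {a b : ℝ → ℝ} (hAB : A = B) (ha : Continuous a)
    (hb : Continuous b) (ha0 : ∀ t, 0 ≤ a t) (hb0 : ∀ t, 0 ≤ b t)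
    (hA : HasLaw A (volume.withDensity fun t => ENNReal.ofReal (a t)) P)
    (hB : HasLaw B (volume.withDensity fun t => ENNReal.ofReal (b t)) P) : a = b := by
  subst hAB
  have := hA.map_eq.symm.trans hB.map_eq
  rw [withDensity_eq_iff_of_sigmaFinite (by fun_prop) (by fun_prop)] at this
  rw [← Continuous.ae_eq_iff_eq volume ha hb]
  filter_upwards [this] with t ht
  exact (ENNReal.ofReal_eq_ofReal_iff (ha0 t) (hb0 t)).1 ht

lemma integrable_of_hasLaw_withDensity [IsProbabilityMeasure P] {A : Ω → ℝ}
    {a : ℝ → ℝ} (ha : Measurable a)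
    (ha0 : ∀ t, 0 ≤ a t)
    (hA : HasLaw A (volume.withDensity fun t => ENNReal.ofReal (a t)) P) : Integrable a := by
  refine ⟨ha.aestronglyMeasurable, ?_⟩
  rw [hasFiniteIntegral_iff_ofReal (ae_of_all _ ha0), ← setLIntegral_univ,
    ← withDensity_apply _ MeasurableSet.univ, ← hA.map_eq]
  have : IsProbabilityMeasure (P.map A) := Measure.isProbabilityMeasure_map hA.aemeasurable
  simp

lemma measureReal_preimage_of_hasLaw_withDensity {A : Ω → ℝ} {a : ℝ → ℝ} (ha : Measurable a)
    (ha0 : ∀ t, 0 ≤ a t)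
    (hA : HasLaw A (volume.withDensity fun t => ENNReal.ofReal (a t)) P) {s : Set ℝ}
    (hs : MeasurableSet s) : P.real (A ⁻¹' s) = ∫ t in s, a t := by
  rw [measureReal_def, ← Measure.map_apply_of_aemeasurable hA.aemeasurable hs, hA.map_eq,
    withDensity_apply _ hs,
    integral_eq_lintegral_of_nonneg_ae (ae_of_all _ ha0) ha.aestronglyMeasurable]

lemma hasDerivAt_cdf_of_hasLaw_withDensity [IsProbabilityMeasure P] {A : Ω → ℝ}
    {a : ℝ → ℝ} (ha : Measurable a)
    (ha0 : ∀ t, 0 ≤ a t)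
    (hA : HasLaw A (volume.withDensity fun t => ENNReal.ofReal (a t)) P) {t : ℝ}
    (hc : ContinuousAt a t) : HasDerivAt (fun s => P.real {ω | A ω ≤ s}) (a t) t := by
  have hi := integrable_of_hasLaw_withDensity ha ha0 hA
  have h : (fun s => P.real {ω | A ω ≤ s}) =
      fun s => (∫ u in (0 : ℝ)..s, a u) + ∫ u in Set.Iic 0, a u := by
    funext s
    rw [← intervalIntegral.integral_Iic_sub_Iic hi.integrableOn hi.integrableOn, sub_add_cancel,
      ← measureReal_preimage_of_hasLaw_withDensity ha ha0 hA measurableSet_Iic]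
    rfl
  rw [h]
  exact (intervalIntegral.integral_hasDerivAt_right hi.intervalIntegrable
    (ha.stronglyMeasurable.stronglyMeasurableAtFilter) hc).add_const _

lemma continuous_cdf_of_hasLaw_withDensity [IsProbabilityMeasure P] {A : Ω → ℝ}
    {a : ℝ → ℝ} (ha : Measurable a)
    (ha0 : ∀ t, 0 ≤ a t)
    (hA : HasLaw A (volume.withDensity fun t => ENNReal.ofReal (a t)) P) :
    Continuous fun s => P.real {ω | A ω ≤ s} := by
  have hi := integrable_of_hasLaw_withDensity ha ha0 hA
  have h : (fun s => P.real {ω | A ω ≤ s}) =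
      fun s => (∫ u in (0 : ℝ)..s, a u) + ∫ u in Set.Iic 0, a u := by
    funext s
    rw [← intervalIntegral.integral_Iic_sub_Iic hi.integrableOn hi.integrableOn, sub_add_cancel,
      ← measureReal_preimage_of_hasLaw_withDensity ha ha0 hA measurableSet_Iic]
    rfl
  rw [h]
  exact (intervalIntegral.continuous_primitive (fun _ _ => hi.intervalIntegrable) 0).add_const _

end Density

/-! ### Tails and moments of the exponential law -/

lemma expMeasure_eq_withDensity (r : ℝ) :
    expMeasure r = volume.withDensity (exponentialPDF r) := rfl

lemma expMeasure_Ioi {r : ℝ} (hr : 0 < r) {u : ℝ} (hu : 0 ≤ u) :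
    expMeasure r (Set.Ioi u) = ENNReal.ofReal (Real.exp (-(r * u))) := by
  have := isProbabilityMeasure_expMeasure hr
  have h := ofReal_cdf (expMeasure r) u
  rw [cdf_expMeasure_eq hr, if_pos hu] at h
  rw [← Set.compl_Iic, prob_compl_eq_one_sub measurableSet_Iic, ← h, ← ENNReal.ofReal_one,
    ← ENNReal.ofReal_sub _ (by simp [mul_nonneg hr.le hu])]
  congr 1
  ring

lemma expMeasure_Iio_zero (r : ℝ) : expMeasure r (Set.Iio 0) = 0 := by
  rw [expMeasure_eq_withDensity, withDensity_apply _ measurableSet_Iio,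
    lintegral_exponentialPDF_of_nonpos le_rfl]

lemma lintegral_exp_mul_expMeasure {r μ : ℝ} (hr : 0 < r) (h : μ < r) :
    ∫⁻ x, ENNReal.ofReal (Real.exp (μ * x)) ∂(expMeasure r) = ENNReal.ofReal (r / (r - μ)) := by
  have hp : 0 < r - μ := sub_pos.2 h
  have hm : ∀ s, Measurable (exponentialPDF s) := fun s =>
    (measurable_exponentialPDFReal s).ennreal_ofReal
  rw [expMeasure_eq_withDensity, lintegral_withDensity_eq_lintegral_mul _ (hm r) (by fun_prop)]
  -- Exponential tilting: the weighted density is a multiple of the density with rate `r - μ`.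
  have : ∀ x, (exponentialPDF r * fun x => ENNReal.ofReal (Real.exp (μ * x))) x =
      ENNReal.ofReal (r / (r - μ)) * exponentialPDF (r - μ) x := by
    intro x
    simp only [Pi.mul_apply, exponentialPDF_eq]
    rw [← ENNReal.ofReal_mul (by split_ifs <;> positivity),
      ← ENNReal.ofReal_mul (by positivity)]
    congr 1
    split_ifs
    · rw [mul_assoc, ← Real.exp_add]
      field_simp
      ring_nf
    · simp
  simp_rw [this]
  rw [lintegral_const_mul _ (hm _), lintegral_exponentialPDF_eq_one hp, mul_one]

/-- A crude bound suffices for summability: `x ≤ (2 / r) * exp (r x / 2)`, and the exponential has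
mean `2`. -/
lemma lintegral_ofReal_expMeasure_le {r : ℝ} (hr : 0 < r) :
    ∫⁻ x, ENNReal.ofReal x ∂(expMeasure r) ≤ ENNReal.ofReal (4 / r) := by
  calc ∫⁻ x, ENNReal.ofReal x ∂(expMeasure r)
      ≤ ∫⁻ x, ENNReal.ofReal (2 / r) * ENNReal.ofReal (Real.exp (r / 2 * x)) ∂(expMeasure r) := by
        refine lintegral_mono fun x => ?_
        rw [← ENNReal.ofReal_mul (by positivity)]
        refine ENNReal.ofReal_le_ofReal ?_
        have := Real.add_one_le_exp (r / 2 * x)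
        calc x = 2 / r * (r / 2 * x) := by field_simp
          _ ≤ _ := by gcongr; linarith
    _ = _ := by
        rw [lintegral_const_mul _ (by fun_prop), lintegral_exp_mul_expMeasure hr (by linarith),
          ← ENNReal.ofReal_mul (by positivity)]
        congr 1
        field_simp
        ring

/-! ### Independence and measurability of blocks of the sequence -/

section Block

variable {Ω : Type*}

lemma indepFun_of_measurable_iSup [MeasurableSpace Ω] {P : Measure Ω} {Y : ℕ → Ω → ℝ} (hm : ∀ n, Measurable (Y n))
    (hY : iIndepFun Y P) {S T : Set ℕ} (hST : Disjoint S T) {U V : Ω → ℝ}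
    (hU : Measurable[⨆ i ∈ S, MeasurableSpace.comap (Y i) inferInstance] U)
    (hV : Measurable[⨆ i ∈ T, MeasurableSpace.comap (Y i) inferInstance] V) :
    IndepFun U V P := by
  rw [IndepFun_iff_Indep]
  exact indep_of_indep_of_le
    (indep_iSup_of_disjoint (fun i => (hm i).comap_le) hY.iIndep hST) hU.comap_le hV.comap_le

lemma measurable_arrival_of {m : MeasurableSpace Ω} {Y : ℕ → Ω → ℝ} {n : ℕ}
    (h : ∀ i < n, Measurable[m] (Y i)) : Measurable[m] (arrival Y n) := by
  unfold arrival
  exact Finset.measurable_sum _ fun i hi => h i (Finset.mem_range.1 hi)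

lemma measurable_total_of {m : MeasurableSpace Ω} {Y : ℕ → Ω → ℝ}
    (hs : ∀ ω, Summable fun n => Y n ω) (h : ∀ i, Measurable[m] (Y i)) :
    Measurable[m] (total Y) := by
  refine measurable_of_tendsto_metrizable (f := fun n => arrival Y n)
    (fun n => measurable_arrival_of fun i _ => h i) ?_
  rw [tendsto_pi_nhds]
  exact fun ω => (hs ω).hasSum.tendsto_sum_nat

lemma measurable_iSup_comap {Y : ℕ → Ω → ℝ} {S : Set ℕ} {i : ℕ} (hi : i ∈ S) :
    Measurable[⨆ i ∈ S, MeasurableSpace.comap (Y i) inferInstance] (Y i) :=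
  Measurable.mono (comap_measurable (Y i))
    (le_iSup₂ (f := fun i (_ : i ∈ S) => MeasurableSpace.comap (Y i) inferInstance) i hi) le_rfl

end Block

namespace IsExpSeq

variable {Ω : Type*} [MeasurableSpace Ω] {P : Measure Ω} {r : ℕ → ℝ}
  {Y : ℕ → Ω → ℝ}

lemma shift (h : IsExpSeq P r Y) (n : ℕ) : IsExpSeq P (fun i => r (i + n)) fun i => Y (i + n) where
  measurable _ := h.measurable _
  nonneg _ := h.nonneg _
  summable ω := (summable_nat_add_iff n).2 (h.summable ω)
  indep := h.indep.precomp (add_left_injective n)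
  law _ := h.law _
  rate_pos _ := h.rate_pos _
  rate_summable := (summable_nat_add_iff n).2 h.rate_summable

lemma measurable_arrival (h : IsExpSeq P r Y) (n : ℕ) : Measurable (arrival Y n) :=
  measurable_arrival_of fun i _ => h.measurable i

lemma measurable_total (h : IsExpSeq P r Y) : Measurable (total Y) :=
  measurable_total_of h.summable h.measurable

lemma arrival_nonneg (h : IsExpSeq P r Y) (n : ℕ) (ω : Ω) : 0 ≤ arrival Y n ω :=
  Finset.sum_nonneg fun i _ => h.nonneg i ω

lemma arrival_mono (h : IsExpSeq P r Y) (ω : Ω) : Monotone fun n => arrival Y n ω :=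
  monotone_nat_of_le_succ fun n => by
    simp only [arrival, Finset.sum_range_succ]
    linarith [h.nonneg n ω]

lemma tendsto_arrival (h : IsExpSeq P r Y) (ω : Ω) :
    Tendsto (fun n => arrival Y n ω) atTop (𝓝 (total Y ω)) :=
  (h.summable ω).hasSum.tendsto_sum_nat

lemma arrival_le_total (h : IsExpSeq P r Y) (n : ℕ) (ω : Ω) : arrival Y n ω ≤ total Y ω :=
  (h.summable ω).sum_le_tsum _ fun i _ => h.nonneg i ω

lemma total_nonneg (h : IsExpSeq P r Y) (ω : Ω) : 0 ≤ total Y ω :=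
  tsum_nonneg fun i => h.nonneg i ω

lemma total_eq (h : IsExpSeq P r Y) (n : ℕ) (ω : Ω) :
    total Y ω = arrival Y n ω + total (fun i => Y (i + n)) ω :=
  ((h.summable ω).sum_add_tsum_nat_add n).symm

lemma indepFun_arrival_arrival (h : IsExpSeq P r Y) (n m : ℕ) :
    IndepFun (arrival Y n) (arrival (fun i => Y (i + n)) m) P :=
  indepFun_of_measurable_iSup h.measurable h.indep (S := Set.Iio n) (T := Set.Ici n)
    (Set.Iio_disjoint_Ici le_rfl)
    (measurable_arrival_of fun _ hi => measurable_iSup_comap (Set.mem_Iio.2 hi))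
    (measurable_arrival_of fun _ _ => measurable_iSup_comap (Set.mem_Ici.2 (Nat.le_add_left _ _)))

lemma indepFun_arrival_total (h : IsExpSeq P r Y) (n : ℕ) :
    IndepFun (arrival Y n) (total fun i => Y (i + n)) P :=
  indepFun_of_measurable_iSup h.measurable h.indep (S := Set.Iio n) (T := Set.Ici n)
    (Set.Iio_disjoint_Ici le_rfl)
    (measurable_arrival_of fun _ hi => measurable_iSup_comap (Set.mem_Iio.2 hi))
    (measurable_total_of (h.shift n).summable fun _ =>
      measurable_iSup_comap (Set.mem_Ici.2 (Nat.le_add_left _ _)))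

lemma indepFun_arrival_self (h : IsExpSeq P r Y) (n : ℕ) : IndepFun (arrival Y n) (Y n) P :=
  indepFun_of_measurable_iSup h.measurable h.indep (S := Set.Iio n) (T := Set.Ici n)
    (Set.Iio_disjoint_Ici le_rfl)
    (measurable_arrival_of fun _ hi => measurable_iSup_comap (Set.mem_Iio.2 hi))
    (measurable_iSup_comap (Set.mem_Ici.2 le_rfl))

end IsExpSeq

lemma arrival_add {Ω : Type*} (Y : ℕ → Ω → ℝ) (n m : ℕ) (ω : Ω) :
    arrival Y (n + m) ω = arrival Y n ω + arrival (fun i => Y (i + n)) m ω := by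
  simp only [arrival, Finset.sum_range_add, add_comm]

lemma arrival_succ {Ω : Type*} (Y : ℕ → Ω → ℝ) (n : ℕ) (ω : Ω) :
    arrival Y (n + 1) ω = arrival Y n ω + Y n ω := by
  simp only [arrival, Finset.sum_range_succ]

/-- The rate `r n` times the probability that the process with sojourn times `Y` has jumped
exactly `n` times by time `t`; this is the density of the time of the jump number `n + 1`. -/
noncomputable def jumpDensity {Ω : Type*} [MeasurableSpace Ω] (P : Measure Ω) (r : ℕ → ℝ)
    (Y : ℕ → Ω → ℝ) (n : ℕ) (t : ℝ) : ℝ :=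
  r n * P.real {ω | arrival Y n ω ≤ t ∧ t < arrival Y (n + 1) ω}

/-! ### Growth and comparison for solutions of `v' = c (u - v)` -/

section Growth

variable {u v : ℝ → ℝ} {c C t₀ : ℝ}

/-- From `u ≤ C v` and `v ≥ 0` follows `v' ≤ c C v`, so `exp (-c C t) * v t` is decreasing. -/
lemma growth_bound_of_le_mul (ht₀ : 0 < t₀) (hc : 0 ≤ c) (hv : ∀ t, 0 ≤ v t)
    (hb : ∀ t, t₀ ≤ t → u t ≤ C * v t)
    (hd : ∀ t, 0 < t → HasDerivAt v (c * (u t - v t)) t) (s t : ℝ) (hs : t₀ ≤ s) (hst : s ≤ t) :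
    v t ≤ Real.exp (c * C * (t - s)) * v s := by
  have hd' : ∀ t, 0 < t → HasDerivAt (fun t => Real.exp (-(c * C) * t) * v t)
      (Real.exp (-(c * C) * t) * (c * (u t - v t - C * v t))) t := fun t ht => by
    have h1 : HasDerivAt (fun t => Real.exp (-(c * C) * t))
        (Real.exp (-(c * C) * t) * (-(c * C) * 1)) t := ((hasDerivAt_id t).const_mul _).exp
    exact (h1.mul (hd t ht)).congr_deriv (by ring)
  have hanti : AntitoneOn (fun t => Real.exp (-(c * C) * t) * v t) (Set.Ici t₀) := by
    refine antitoneOn_of_deriv_nonpos (convex_Ici _)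
      (fun t ht => (hd' t (ht₀.trans_le ht)).continuousAt.continuousWithinAt)
      (fun t ht => (hd' t (ht₀.trans_le
        (interior_subset ht))).differentiableAt.differentiableWithinAt) fun t ht => ?_
    have ht' : t₀ ≤ t := interior_subset ht
    rw [(hd' t (ht₀.trans_le ht')).deriv]
    refine mul_nonpos_of_nonneg_of_nonpos (Real.exp_nonneg _)
      (mul_nonpos_of_nonneg_of_nonpos hc ?_)
    linarith [hb t ht', hv t]
  have h := hanti hs (hs.trans hst) hst
  calc v t = Real.exp (c * C * t) * (Real.exp (-(c * C) * t) * v t) := by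
        rw [← mul_assoc, ← Real.exp_add]; simp
    _ ≤ Real.exp (c * C * t) * (Real.exp (-(c * C) * s) * v s) := by gcongr
    _ = _ := by rw [← mul_assoc, ← Real.exp_add]; ring_nf

/-- The derivative of `exp (c t) * v t` is `c * exp (c t) * u t`. By the growth bound, `u` on `[t -
t₀/2, t]` is at least a fixed multiple of `u t`, so the mean value inequality over that interval
bounds `v t` from below. -/
lemma le_mul_of_growth_bound (hc : 0 < c) (ht₀ : 0 < t₀)
    (hg : ∀ s t, t₀ / 2 ≤ s → s ≤ t → u t ≤ Real.exp (C * (t - s)) * u s)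
    (hC : 0 ≤ C) (hu : ∀ t, 0 ≤ u t) (hv : ∀ t, 0 ≤ v t)
    (hd : ∀ t, 0 < t → HasDerivAt v (c * (u t - v t)) t) :
    ∃ K, 0 ≤ K ∧ ∀ t, t₀ ≤ t → u t ≤ K * v t := by
  have hd' : ∀ t, 0 < t → HasDerivAt (fun t => Real.exp (c * t) * v t)
      (Real.exp (c * t) * (c * u t)) t := fun t ht => by
    have h1 : HasDerivAt (fun t => Real.exp (c * t))
        (Real.exp (c * t) * (c * 1)) t := ((hasDerivAt_id t).const_mul _).exp
    exact (h1.mul (hd t ht)).congr_deriv (by ring)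
  set δ := t₀ / 2 with hδ
  have hδ0 : 0 < δ := half_pos ht₀
  have hK : 0 < c * δ * Real.exp (-((c + C) * δ)) := by positivity
  refine ⟨(c * δ * Real.exp (-((c + C) * δ)))⁻¹, by positivity, fun t ht => ?_⟩
  rw [inv_mul_eq_div, le_div_iff₀ hK]
  have hpos : ∀ s ∈ Set.Icc (t - δ) t, δ ≤ s := fun s hs => by linarith [hs.1]
  have key := (convex_Icc (t - δ) t).mul_sub_le_image_sub_of_le_deriv
    (f := fun t => Real.exp (c * t) * v t)
    (C := Real.exp (c * (t - δ)) * (c * (Real.exp (-(C * δ)) * u t)))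
    (fun s hs => (hd' s (hδ0.trans_le (hpos s hs))).continuousAt.continuousWithinAt)
    (fun s hs => (hd' s (hδ0.trans_le
      (hpos s (interior_subset hs)))).differentiableAt.differentiableWithinAt)
    (fun s hs => by
      have hs' := interior_subset hs
      rw [(hd' s (hδ0.trans_le (hpos s hs'))).deriv]
      have h1 := hg s t (hpos s hs') hs'.2
      have h2 : Real.exp (-(C * δ)) * u t ≤ u s := by
        calc Real.exp (-(C * δ)) * u t ≤ Real.exp (-(C * δ)) * (Real.exp (C * (t - s)) * u s) := by
              gcongr
          _ ≤ Real.exp (-(C * δ)) * (Real.exp (C * δ) * u s) := by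
              have := hu s
              gcongr
              linarith [hs'.1]
          _ = u s := by rw [← mul_assoc, ← Real.exp_add]; simp
      have := hu t
      gcongr
      exact hs'.1)
    (t - δ) ⟨le_rfl, by linarith⟩ t ⟨by linarith, le_rfl⟩ (by linarith)
  have h3 : 0 ≤ Real.exp (c * (t - δ)) * v (t - δ) := mul_nonneg (Real.exp_nonneg _) (hv _)
  have h4 : Real.exp (c * (t - δ)) * (c * (Real.exp (-(C * δ)) * u t)) * (t - (t - δ)) ≤
      Real.exp (c * t) * v t := by
    linarith
  have h5 : Real.exp (c * t) * (u t * (c * δ * Real.exp (-((c + C) * δ)))) ≤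
      Real.exp (c * t) * v t := by
    refine le_trans (le_of_eq ?_) h4
    have : Real.exp (c * (t - δ)) * Real.exp (-(C * δ)) =
        Real.exp (c * t) * Real.exp (-((c + C) * δ)) := by
      rw [← Real.exp_add, ← Real.exp_add]; ring_nf
    linear_combination (-u t * c * δ) * this
  exact le_of_mul_le_mul_left h5 (Real.exp_pos _)

end Growth

/-! ### Jump densities: forward equation, positivity, comparison -/

namespace IsExpSeq

variable {Ω : Type*} [MeasurableSpace Ω] {P : Measure Ω} {r : ℕ → ℝ}
  {Y : ℕ → Ω → ℝ}

lemma jumpDensity_nonneg (h : IsExpSeq P r Y) (n : ℕ) (t : ℝ) : 0 ≤ jumpDensity P r Y n t :=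
  mul_nonneg (h.rate_pos n).le measureReal_nonneg

lemma jumpDensity_le [IsProbabilityMeasure P] (h : IsExpSeq P r Y) (n : ℕ) (t : ℝ) : jumpDensity P r Y n t ≤ r n :=
  mul_le_of_le_one_right (h.rate_pos n).le measureReal_le_one

lemma jumpDensity_eq_sub [IsProbabilityMeasure P] (h : IsExpSeq P r Y) (n : ℕ) (t : ℝ) :
    jumpDensity P r Y n t =
      r n * (P.real {ω | arrival Y n ω ≤ t} - P.real {ω | arrival Y (n + 1) ω ≤ t}) := by
  have hsub : {ω | arrival Y (n + 1) ω ≤ t} ⊆ {ω | arrival Y n ω ≤ t} := fun ω hω =>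
    (h.arrival_mono ω n.le_succ).trans hω
  rw [jumpDensity, ← measureReal_sdiff hsub
    (measurableSet_le (h.measurable_arrival _) measurable_const)]
  congr 2
  ext ω
  simp [Set.mem_sdiff]

/-- Condition on `arrival Y n`, which is independent of `Y n`: the next sojourn must outlast the
remaining time `t - arrival Y n`. -/
lemma measure_arrival_le_lt [IsProbabilityMeasure P] (h : IsExpSeq P r Y) (n : ℕ) (t : ℝ) :
    P {ω | arrival Y n ω ≤ t ∧ t < arrival Y (n + 1) ω} =
      ∫⁻ ω, (if arrival Y n ω ≤ t then ENNReal.ofReal (Real.exp (-(r n * (t - arrival Y n ω))))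
        else 0) ∂P := by
  have hA := h.measurable_arrival n
  have hi := (indepFun_iff_map_prod_eq_prod_map_map hA.aemeasurable
    (h.measurable n).aemeasurable).1 (h.indepFun_arrival_self n)
  rw [(h.law n).map_eq] at hi
  have : IsProbabilityMeasure (expMeasure (r n)) := isProbabilityMeasure_expMeasure (h.rate_pos n)
  have hs : MeasurableSet {p : ℝ × ℝ | p.1 ≤ t ∧ t < p.1 + p.2} :=
    (measurableSet_le measurable_fst measurable_const).inter
      (measurableSet_lt measurable_const (measurable_fst.add measurable_snd))
  have e : {ω | arrival Y n ω ≤ t ∧ t < arrival Y (n + 1) ω} =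
      (fun ω => (arrival Y n ω, Y n ω)) ⁻¹' {p : ℝ × ℝ | p.1 ≤ t ∧ t < p.1 + p.2} := by
    ext ω
    simp [arrival_succ]
  rw [e, ← Measure.map_apply (hA.prodMk (h.measurable n)) hs, hi, Measure.prod_apply hs,
    lintegral_map (measurable_measure_prodMk_left hs) hA]
  refine lintegral_congr fun ω => ?_
  split_ifs with hω
  · rw [← expMeasure_Ioi (h.rate_pos n) (sub_nonneg.2 hω)]
    congr 1
    ext y
    simp [hω, sub_lt_iff_lt_add']
  · convert measure_empty (μ := expMeasure (r n))
    ext y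
    simp [hω]

lemma hasLaw_arrival_succ [IsProbabilityMeasure P] (h : IsExpSeq P r Y) (n : ℕ) :
    HasLaw (arrival Y (n + 1))
      (volume.withDensity fun t => ENNReal.ofReal (jumpDensity P r Y n t)) P := by
  have hl := hasLaw_add_of_density (a := exponentialPDF (r n))
    ((measurable_exponentialPDFReal _).ennreal_ofReal) (h.law n) (h.measurable_arrival n)
    (h.indepFun_arrival_self n).symm
  have e : arrival Y (n + 1) = fun ω => Y n ω + arrival Y n ω := by
    funext ω
    rw [arrival_succ, add_comm]
  rw [e]
  convert hl using 3 with t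
  rw [jumpDensity, ENNReal.ofReal_mul (h.rate_pos n).le, ofReal_measureReal,
    h.measure_arrival_le_lt n t, ← lintegral_const_mul']
  · refine lintegral_congr fun ω => ?_
    simp only [exponentialPDF_eq, sub_nonneg]
    split_ifs
    · rw [ENNReal.ofReal_mul (h.rate_pos n).le]
    · simp
  · simp

lemma measurable_jumpDensity [IsProbabilityMeasure P] (h : IsExpSeq P r Y) (n : ℕ) : Measurable (jumpDensity P r Y n) := by
  have e : jumpDensity P r Y n = fun t =>
      r n * (P.real {ω | arrival Y n ω ≤ t} - P.real {ω | arrival Y (n + 1) ω ≤ t}) :=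
    funext fun t => h.jumpDensity_eq_sub n t
  have hm : ∀ k, Measurable fun t => P.real {ω | arrival Y k ω ≤ t} := fun k =>
    Monotone.measurable fun s t hst => measureReal_mono fun ω (hω : _ ≤ s) => hω.trans hst
  rw [e]
  exact ((hm _).sub (hm _)).const_mul _

/-- The index starts at `1` because the density of a single exponential variable jumps at `0`. -/
lemma continuous_jumpDensity [IsProbabilityMeasure P] (h : IsExpSeq P r Y) (n : ℕ) :
    Continuous (jumpDensity P r Y (n + 1)) := by
  have hc : ∀ k, Continuous fun t => P.real {ω | arrival Y (k + 1) ω ≤ t} := fun k =>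
    continuous_cdf_of_hasLaw_withDensity (h.measurable_jumpDensity k) (h.jumpDensity_nonneg k)
      (h.hasLaw_arrival_succ k)
  have e : jumpDensity P r Y (n + 1) = fun t => r (n + 1) *
      (P.real {ω | arrival Y (n + 1) ω ≤ t} - P.real {ω | arrival Y (n + 1 + 1) ω ≤ t}) :=
    funext fun t => h.jumpDensity_eq_sub (n + 1) t
  rw [e]
  exact ((hc _).sub (hc _)).const_mul _

lemma jumpDensity_zero [IsProbabilityMeasure P] (h : IsExpSeq P r Y) {t : ℝ} (ht : 0 ≤ t) :
    jumpDensity P r Y 0 t = r 0 * Real.exp (-(r 0 * t)) := by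
  rw [jumpDensity, measureReal_def, h.measure_arrival_le_lt 0 t]
  simp [arrival, ht, Real.exp_nonneg]

lemma continuousAt_jumpDensity [IsProbabilityMeasure P] (h : IsExpSeq P r Y) (n : ℕ) {t : ℝ} (ht : 0 < t) :
    ContinuousAt (jumpDensity P r Y n) t := by
  cases n with
  | zero =>
    have hc : ContinuousAt (fun t => r 0 * Real.exp (-(r 0 * t))) t := by fun_prop
    refine hc.congr ?_
    filter_upwards [lt_mem_nhds ht] with s hs
    exact (h.jumpDensity_zero (le_of_lt hs)).symm
  | succ n => exact (h.continuous_jumpDensity n).continuousAt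

/-- The forward equation: `jumpDensity` is the rate times a difference of two distribution
functions, whose derivatives are consecutive jump densities. -/
lemma hasDerivAt_jumpDensity_of_continuousAt [IsProbabilityMeasure P] (h : IsExpSeq P r Y) (n : ℕ) {t : ℝ}
    (hc : ContinuousAt (jumpDensity P r Y n) t) :
    HasDerivAt (jumpDensity P r Y (n + 1))
      (r (n + 1) * (jumpDensity P r Y n t - jumpDensity P r Y (n + 1) t)) t := by
  have e : jumpDensity P r Y (n + 1) = fun t => r (n + 1) *
      (P.real {ω | arrival Y (n + 1) ω ≤ t} - P.real {ω | arrival Y (n + 1 + 1) ω ≤ t}) :=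
    funext fun t => h.jumpDensity_eq_sub (n + 1) t
  have hd := fun k (hk : ContinuousAt (jumpDensity P r Y k) t) =>
    hasDerivAt_cdf_of_hasLaw_withDensity (h.measurable_jumpDensity k) (h.jumpDensity_nonneg k)
      (h.hasLaw_arrival_succ k) hk
  have := ((hd n hc).sub (hd (n + 1) (h.continuous_jumpDensity n).continuousAt)).const_mul
    (r (n + 1))
  rw [e]
  exact e ▸ this

lemma jumpDensity_zero_antitone [IsProbabilityMeasure P] (h : IsExpSeq P r Y) {s t : ℝ}
    (hs : 0 < s) (hst : s ≤ t) :
    jumpDensity P r Y 0 t ≤ jumpDensity P r Y 0 s := by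
  rw [h.jumpDensity_zero hs.le, h.jumpDensity_zero (hs.le.trans hst)]
  have := (h.rate_pos 0).le
  gcongr

/-- On `[t₀, ∞)`, `jumpDensity P r Y n` grows at most exponentially. -/
lemma exists_growth_bound [IsProbabilityMeasure P] (h : IsExpSeq P r Y) (n : ℕ) {t₀ : ℝ}
    (ht₀ : 0 < t₀) :
    ∃ C, 0 ≤ C ∧ ∀ s t, t₀ ≤ s → s ≤ t →
      jumpDensity P r Y n t ≤ Real.exp (C * (t - s)) * jumpDensity P r Y n s := by
  induction n generalizing t₀ with
  | zero =>
    exact ⟨0, le_rfl, fun s t hs hst => by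
      simpa using h.jumpDensity_zero_antitone (ht₀.trans_le hs) hst⟩
  | succ n ih =>
    -- The comparison at `t` looks back over `[t - t₀/2, t]`, so the inductive bound is needed from
    -- `t₀ / 2` on.
    obtain ⟨C, hC, hg⟩ := ih (half_pos ht₀)
    obtain ⟨C', hC', hb⟩ := le_mul_of_growth_bound (h.rate_pos (n + 1)) ht₀ hg hC
      (h.jumpDensity_nonneg n) (h.jumpDensity_nonneg (n + 1))
      fun t ht => h.hasDerivAt_jumpDensity_of_continuousAt n (h.continuousAt_jumpDensity n ht)
    exact ⟨r (n + 1) * C', mul_nonneg (h.rate_pos _).le hC', growth_bound_of_le_mul ht₀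
      (h.rate_pos (n + 1)).le (h.jumpDensity_nonneg (n + 1)) hb
      fun t ht => h.hasDerivAt_jumpDensity_of_continuousAt n (h.continuousAt_jumpDensity n ht)⟩

/-- On `[t₀, ∞)`, `jumpDensity P r Y n` is at most a multiple of the next density. -/
lemma exists_jumpDensity_le_mul_succ [IsProbabilityMeasure P] (h : IsExpSeq P r Y) (n : ℕ)
    {t₀ : ℝ} (ht₀ : 0 < t₀) :
    ∃ C, 0 ≤ C ∧ ∀ t, t₀ ≤ t → jumpDensity P r Y n t ≤ C * jumpDensity P r Y (n + 1) t := by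
  obtain ⟨C, hC, hg⟩ := h.exists_growth_bound n (half_pos ht₀)
  exact le_mul_of_growth_bound (h.rate_pos (n + 1)) ht₀ hg hC
      (h.jumpDensity_nonneg n) (h.jumpDensity_nonneg (n + 1))
      fun t ht => h.hasDerivAt_jumpDensity_of_continuousAt n (h.continuousAt_jumpDensity n ht)

lemma jumpDensity_pos [IsProbabilityMeasure P] (h : IsExpSeq P r Y) (n : ℕ) {t : ℝ}
    (ht : 0 < t) : 0 < jumpDensity P r Y n t := by
  induction n with
  | zero =>
    rw [h.jumpDensity_zero ht.le]
    exact mul_pos (h.rate_pos 0) (Real.exp_pos _)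
  | succ n ih =>
    obtain ⟨C, hC, hb⟩ := h.exists_jumpDensity_le_mul_succ n ht
    exact pos_of_mul_pos_right (ih.trans_le (hb t le_rfl)) hC

/-- The forward equation makes the derivative nonnegative. With index at least `2` it holds on all
of `ℝ`, also across `0`, so backward shifts of any size are controlled. -/
lemma jumpDensity_mul_exp_mono [IsProbabilityMeasure P] (h : IsExpSeq P r Y) (n : ℕ) :
    Monotone fun t => Real.exp (r (n + 2) * t) * jumpDensity P r Y (n + 2) t := by
  have hd : ∀ t, HasDerivAt (fun t => Real.exp (r (n + 2) * t) * jumpDensity P r Y (n + 2) t)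
      (Real.exp (r (n + 2) * t) * (r (n + 2) * jumpDensity P r Y (n + 1) t)) t := fun t => by
    have h1 : HasDerivAt (fun t => Real.exp (r (n + 2) * t))
        (Real.exp (r (n + 2) * t) * (r (n + 2) * 1)) t := ((hasDerivAt_id t).const_mul _).exp
    exact (h1.mul (h.hasDerivAt_jumpDensity_of_continuousAt (n + 1)
      (h.continuous_jumpDensity n).continuousAt)).congr_deriv (by ring)
  refine monotone_of_deriv_nonneg (fun t => (hd t).differentiableAt) fun t => ?_
  rw [(hd t).deriv]
  exact mul_nonneg (Real.exp_nonneg _) (mul_nonneg (h.rate_pos _).le (h.jumpDensity_nonneg _ _))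

end IsExpSeq

/-! ### Density of the total, exponential moments, increments of jump densities -/

/-- The density of `∑_i Y i`, as the convolution of the density of `Y 0 + Y 1` with the law of
the remainder. -/
noncomputable def totalDensity {Ω : Type*} [MeasurableSpace Ω] (P : Measure Ω) (r : ℕ → ℝ)
    (Y : ℕ → Ω → ℝ) (t : ℝ) : ℝ :=
  ∫ ω, jumpDensity P r Y 1 (t - total (fun i => Y (i + 2)) ω) ∂P

namespace IsExpSeq

variable {Ω : Type*} [MeasurableSpace Ω] {P : Measure Ω} {r : ℕ → ℝ} {Y : ℕ → Ω → ℝ}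

lemma tendsto_rate (h : IsExpSeq P r Y) : Tendsto r atTop atTop := by
  have h0 : Tendsto (fun n => 1 / r n) atTop (𝓝[>] 0) :=
    tendsto_nhdsWithin_iff.2 ⟨h.rate_summable.tendsto_atTop_zero,
      Eventually.of_forall fun n => one_div_pos.2 (h.rate_pos n)⟩
  simpa [Function.comp_def] using tendsto_inv_nhdsGT_zero.comp h0

lemma exists_rate_lt (h : IsExpSeq P r Y) (m : ℕ) : ∃ n, m ≤ n ∧ ∀ k, n < k → r n < r k := by
  have ht := (tendsto_add_atTop_iff_nat m).2 h.tendsto_rate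
  rw [← Nat.cofinite_eq_atTop] at ht
  obtain ⟨k₀, hk₀⟩ := ht.exists_forall_le
  have hfin : {k | r (k + m) ≤ r (k₀ + m)}.Finite := by
    have := ht.eventually_gt_atTop (r (k₀ + m))
    simpa [Filter.Eventually, Filter.mem_cofinite, Set.compl_def] using this
  -- Take the last index whose rate is at most that of `k₀`; it exists because the rates tend to
  -- infinity.
  obtain ⟨n, hn, hmax⟩ := hfin.exists_maximal ⟨k₀, by simp⟩
  refine ⟨n + m, Nat.le_add_left _ _, fun k hk => ?_⟩
  obtain ⟨j, rfl⟩ : ∃ j, k = j + m := ⟨k - m, by omega⟩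
  refine lt_of_le_of_lt (hn : r (n + m) ≤ _) (lt_of_not_ge fun hj => ?_)
  have := hmax (y := j) hj (by omega)
  omega

lemma hasLaw_total_integral [IsProbabilityMeasure P] (h : IsExpSeq P r Y) (n : ℕ) :
    HasLaw (total Y) (volume.withDensity fun t => ENNReal.ofReal
      (∫ ω, jumpDensity P r Y (n + 1) (t - total (fun i => Y (i + (n + 2))) ω) ∂P)) P := by
  convert hasLaw_add_of_real_density (h.measurable_jumpDensity (n + 1)) (h.jumpDensity_nonneg _)
    (h.jumpDensity_le _) (h.hasLaw_arrival_succ (n + 1)) (h.shift (n + 2)).measurable_total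
    (h.indepFun_arrival_total (n + 2)) using 1
  funext ω
  exact h.total_eq (n + 2) ω

lemma hasLaw_total [IsProbabilityMeasure P] (h : IsExpSeq P r Y) :
    HasLaw (total Y) (volume.withDensity fun t => ENNReal.ofReal (totalDensity P r Y t)) P :=
  h.hasLaw_total_integral 0

lemma continuous_totalDensity [IsProbabilityMeasure P] (h : IsExpSeq P r Y) :
    Continuous (totalDensity P r Y) :=
  continuous_integral_comp_sub (h.continuous_jumpDensity 0) (h.jumpDensity_nonneg _)
    (h.jumpDensity_le _) (h.shift 2).measurable_total

lemma totalDensity_nonneg (h : IsExpSeq P r Y) (t : ℝ) : 0 ≤ totalDensity P r Y t :=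
  integral_nonneg fun _ => h.jumpDensity_nonneg _ _

/-- Frees the splitting point of the series: every split yields a continuous density of the same
law. -/
lemma totalDensity_eq [IsProbabilityMeasure P] (h : IsExpSeq P r Y) (n : ℕ) (t : ℝ) :
    totalDensity P r Y t =
      ∫ ω, jumpDensity P r Y (n + 1) (t - total (fun i => Y (i + (n + 2))) ω) ∂P :=
  congrFun (eq_of_hasLaw_withDensity rfl h.continuous_totalDensity
    (continuous_integral_comp_sub (h.continuous_jumpDensity n) (h.jumpDensity_nonneg _)
      (h.jumpDensity_le _) (h.shift (n + 2)).measurable_total) h.totalDensity_nonneg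
    (fun _ => integral_nonneg fun _ => h.jumpDensity_nonneg _ _)
    h.hasLaw_total (h.hasLaw_total_integral n)) t

lemma jumpDensity_add [IsProbabilityMeasure P] (h : IsExpSeq P r Y) (n m : ℕ) (t : ℝ) :
    jumpDensity P r Y (n + 1 + m) t =
      ∫ ω, jumpDensity P r Y (n + 1) (t - arrival (fun i => Y (i + (n + 2))) m ω) ∂P := by
  have e : arrival Y (n + m + 1 + 1) =
      fun ω => arrival Y (n + 2) ω + arrival (fun i => Y (i + (n + 2))) m ω := by
    funext ω
    rw [← arrival_add]
    congr 1
    omega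
  rw [show n + 1 + m = n + m + 1 by omega]
  exact congrFun (eq_of_hasLaw_withDensity e (h.continuous_jumpDensity _)
    (continuous_integral_comp_sub (h.continuous_jumpDensity n) (h.jumpDensity_nonneg _)
      (h.jumpDensity_le _) ((h.shift (n + 2)).measurable_arrival m)) (h.jumpDensity_nonneg _)
    (fun _ => integral_nonneg fun _ => h.jumpDensity_nonneg _ _)
    (h.hasLaw_arrival_succ _)
    (hasLaw_add_of_real_density (h.measurable_jumpDensity (n + 1)) (h.jumpDensity_nonneg _)
    (h.jumpDensity_le _) (h.hasLaw_arrival_succ (n + 1)) ((h.shift (n + 2)).measurable_arrival m)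
    (h.indepFun_arrival_arrival (n + 2) m))) t

lemma lintegral_exp_mul_arrival (h : IsExpSeq P r Y) [IsProbabilityMeasure P] {μ : ℝ}
    (hμ : ∀ i, μ < r i) (n : ℕ) :
    ∫⁻ ω, ENNReal.ofReal (Real.exp (μ * arrival Y n ω)) ∂P =
      ENNReal.ofReal (∏ i ∈ Finset.range n, r i / (r i - μ)) := by
  induction n with
  | zero => simp [arrival]
  | succ n ih =>
    have hφ : Measurable fun x : ℝ => ENNReal.ofReal (Real.exp (μ * x)) := by fun_prop
    have hi : IndepFun (fun ω => ENNReal.ofReal (Real.exp (μ * arrival Y n ω)))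
        (fun ω => ENNReal.ofReal (Real.exp (μ * Y n ω))) P :=
      (h.indepFun_arrival_self n).comp hφ hφ
    have e : ∀ ω, ENNReal.ofReal (Real.exp (μ * arrival Y (n + 1) ω)) =
        ENNReal.ofReal (Real.exp (μ * arrival Y n ω)) * ENNReal.ofReal (Real.exp (μ * Y n ω)) :=
      fun ω => by
        rw [← ENNReal.ofReal_mul (Real.exp_nonneg _), ← Real.exp_add, arrival_succ, mul_add]
    have hl := lintegral_mul_eq_lintegral_mul_lintegral_of_indepFun
      (hφ.comp (h.measurable_arrival n)) (hφ.comp (h.measurable n)) hi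
    simp only [Pi.mul_apply, Function.comp_apply] at hl
    simp_rw [e]
    rw [hl, ih, (h.law n).lintegral_comp hφ.aemeasurable,
      lintegral_exp_mul_expMeasure (h.rate_pos n) (hμ n), Finset.prod_range_succ,
      ENNReal.ofReal_mul (Finset.prod_nonneg fun i _ =>
        div_nonneg (h.rate_pos i).le (sub_pos.2 (hμ i)).le)]

/-- The moments of the partial sums are products of `r i / (r i - μ) = 1 + μ / (r i - μ)`, bounded
by `exp (∑ μ / (r i - μ))`; monotone convergence passes to the total. -/
lemma integrable_exp_mul_total (h : IsExpSeq P r Y) [IsProbabilityMeasure P] {μ : ℝ}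
    (hμ0 : 0 ≤ μ) (hμ : ∀ i, μ < r i) : Integrable (fun ω => Real.exp (μ * total Y ω)) P := by
  have hp : ∀ i, 0 < r i - μ := fun i => sub_pos.2 (hμ i)
  have hs : Summable fun i => μ / (r i - μ) := by
    refine Summable.of_norm_bounded_eventually_nat (h.rate_summable.mul_left (2 * μ)) ?_
    -- Once `r i ≥ 2 μ`, the term is at most `2 μ / r i`.
    filter_upwards [h.tendsto_rate.eventually_ge_atTop (2 * μ)] with i hi
    rw [Real.norm_of_nonneg (div_nonneg hμ0 (hp i).le), mul_one_div,
      div_le_div_iff₀ (hp i) (h.rate_pos i)]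
    nlinarith
  have hb : ∀ n, ∫⁻ ω, ENNReal.ofReal (Real.exp (μ * arrival Y n ω)) ∂P ≤
      ENNReal.ofReal (Real.exp (∑' i, μ / (r i - μ))) := fun n => by
    rw [h.lintegral_exp_mul_arrival hμ]
    refine ENNReal.ofReal_le_ofReal ?_
    calc ∏ i ∈ Finset.range n, r i / (r i - μ)
        ≤ ∏ i ∈ Finset.range n, Real.exp (μ / (r i - μ)) := by
          refine Finset.prod_le_prod (fun i _ => div_nonneg (h.rate_pos i).le (hp i).le)
            fun i _ => ?_
          refine le_trans (le_of_eq ?_) (Real.add_one_le_exp _)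
          have := (hp i).ne'
          field_simp
          ring
      _ = Real.exp (∑ i ∈ Finset.range n, μ / (r i - μ)) := (Real.exp_sum _ _).symm
      _ ≤ _ := Real.exp_le_exp.2 (hs.sum_le_tsum _ fun i _ => div_nonneg hμ0 (hp i).le)
  have hm := h.measurable_total
  refine ⟨by fun_prop, ?_⟩
  rw [hasFiniteIntegral_iff_ofReal (ae_of_all _ fun ω => Real.exp_nonneg _)]
  have hma : ∀ n, Measurable fun ω => ENNReal.ofReal (Real.exp (μ * arrival Y n ω)) := fun n => by
    have := h.measurable_arrival n
    fun_prop
  refine lt_of_le_of_lt ?_ (ENNReal.ofReal_lt_top (r := Real.exp (∑' i, μ / (r i - μ))))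
  have ht := lintegral_tendsto_of_tendsto_of_monotone (μ := P)
    (f := fun n ω => ENNReal.ofReal (Real.exp (μ * arrival Y n ω)))
    (F := fun ω => ENNReal.ofReal (Real.exp (μ * total Y ω)))
    (fun n => (hma n).aemeasurable)
    (ae_of_all _ fun ω m n hmn => by
      have := h.arrival_mono ω hmn
      simp only at this ⊢
      gcongr)
    (ae_of_all _ fun ω => by
      have hc : Continuous fun x : ℝ => ENNReal.ofReal (Real.exp (μ * x)) :=
        ENNReal.continuous_ofReal.comp (by fun_prop)
      exact (hc.tendsto _).comp (h.tendsto_arrival ω))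
  exact le_of_tendsto' ht hb

lemma jumpDensity_sub_le [IsProbabilityMeasure P] (h : IsExpSeq P r Y) (n : ℕ) (t : ℝ) {b : ℝ}
    (hb : 0 ≤ b) :
    jumpDensity P r Y (n + 2) (t - b) ≤
      Real.exp (r (n + 2) * b) * jumpDensity P r Y (n + 2) t := by
  have := h.jumpDensity_mul_exp_mono n (sub_le_self t hb)
  simp only at this
  calc _ = Real.exp (-(r (n + 2) * (t - b))) *
        (Real.exp (r (n + 2) * (t - b)) * jumpDensity P r Y (n + 2) (t - b)) := by
          rw [← mul_assoc, ← Real.exp_add]; simp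
    _ ≤ Real.exp (-(r (n + 2) * (t - b))) *
        (Real.exp (r (n + 2) * t) * jumpDensity P r Y (n + 2) t) := by gcongr
    _ = _ := by rw [← mul_assoc, ← Real.exp_add]; ring_nf

/-- Two bounds, both relative to the value at `t`: `1` in the minimum comes from the exponential
monotonicity alone and gives domination; the linear term comes from the mean value inequality and
gives convergence to `0`. -/
lemma exists_jumpDensity_sub_sub_le [IsProbabilityMeasure P] (h : IsExpSeq P r Y) (n : ℕ)
    {t₀ : ℝ} (ht₀ : 0 < t₀) :
    ∃ C, 0 ≤ C ∧ ∀ t, t₀ ≤ t → ∀ b b', 0 ≤ b' → b' ≤ b →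
      |jumpDensity P r Y (n + 2) (t - b') - jumpDensity P r Y (n + 2) (t - b)| ≤
        jumpDensity P r Y (n + 2) t * (Real.exp (r (n + 2) * b) * min 1 (C * (b - b'))) := by
  obtain ⟨C, hC, hb⟩ := h.exists_jumpDensity_le_mul_succ (n + 1) ht₀
  set a := jumpDensity P r Y (n + 2) with ha
  set μ := r (n + 2) with hμ
  have hμ0 : 0 < μ := h.rate_pos _
  have hr1 := h.rate_pos (n + 1)
  have ha0 : ∀ t, 0 ≤ a t := h.jumpDensity_nonneg _
  have hat₀ : 0 < a t₀ := h.jumpDensity_pos _ ht₀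
  have hd : ∀ t, HasDerivAt a (μ * (jumpDensity P r Y (n + 1) t - a t)) t := fun t =>
    h.hasDerivAt_jumpDensity_of_continuousAt (n + 1) (h.continuous_jumpDensity n).continuousAt
  have hsub : ∀ t b, 0 ≤ b → a (t - b) ≤ Real.exp (μ * b) * a t := fun t b hb =>
    h.jumpDensity_sub_le n t hb
  -- The first summand serves points `t - v ≥ t₀`, where the previous density is at most `C * a`.
  -- The second serves `t - v ≤ t₀`, where both densities are bounded by their rates and `a t₀ ≤ exp
  -- (μ v) * a t`.
  set K := μ * (C + 1) + μ * (r (n + 1) + μ) / a t₀ with hK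
  have hK1 : 0 ≤ μ * (C + 1) := by positivity
  have hK2 : 0 ≤ μ * (r (n + 1) + μ) / a t₀ := by positivity
  have hder : ∀ t, t₀ ≤ t → ∀ v, 0 ≤ v →
      |μ * (jumpDensity P r Y (n + 1) (t - v) - a (t - v))| ≤ K * (Real.exp (μ * v) * a t) := by
    intro t ht v hv
    have h1 := h.jumpDensity_nonneg (n + 1) (t - v)
    have h2 := ha0 (t - v)
    have h3 : |μ * (jumpDensity P r Y (n + 1) (t - v) - a (t - v))| ≤
        μ * (jumpDensity P r Y (n + 1) (t - v) + a (t - v)) := by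
      rw [abs_mul, abs_of_pos hμ0]
      gcongr
      rw [abs_le]; constructor <;> linarith
    have h5 : 0 ≤ Real.exp (μ * v) * a t := mul_nonneg (Real.exp_nonneg _) (ha0 _)
    refine h3.trans ?_
    rcases le_total t₀ (t - v) with hv' | hv'
    · have h4 := hb _ hv'
      calc μ * (jumpDensity P r Y (n + 1) (t - v) + a (t - v))
          ≤ μ * (C * a (t - v) + a (t - v)) := by gcongr
        _ = μ * (C + 1) * a (t - v) := by ring
        _ ≤ μ * (C + 1) * (Real.exp (μ * v) * a t) := by gcongr; exact hsub _ _ hv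
        _ ≤ _ := by gcongr; linarith
    · have h4 : a t₀ ≤ Real.exp (μ * v) * a t := by
        have := hsub t (t - t₀) (by linarith)
        rw [sub_sub_cancel] at this
        refine this.trans ?_
        have := ha0 t
        gcongr
        linarith
      calc μ * (jumpDensity P r Y (n + 1) (t - v) + a (t - v))
          ≤ μ * (r (n + 1) + μ) := by
            gcongr
            · exact h.jumpDensity_le _ _
            · exact h.jumpDensity_le _ _
        _ = μ * (r (n + 1) + μ) / a t₀ * a t₀ := by field_simp
        _ ≤ μ * (r (n + 1) + μ) / a t₀ * (Real.exp (μ * v) * a t) := by gcongr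
        _ ≤ _ := by gcongr; linarith
  refine ⟨K, by positivity, fun t ht b b' hb' hbb' => ?_⟩
  rw [← mul_assoc, mul_comm (a t), mul_min_of_nonneg _ _ (mul_nonneg (Real.exp_nonneg _) (ha0 _)),
    mul_one]
  have hmono : ∀ v ≤ b, Real.exp (μ * v) * a t ≤ Real.exp (μ * b) * a t := fun v hv => by
    have := ha0 t
    gcongr
  refine le_min ?_ ?_
  · have h1 := (hsub t b' hb').trans (hmono b' hbb')
    have h2 := hsub t b (hb'.trans hbb')
    rw [abs_le]
    constructor <;> linarith [ha0 (t - b), ha0 (t - b')]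
  · have := (convex_Icc (t - b) (t - b')).norm_image_sub_le_of_norm_hasDerivWithin_le
      (f := a) (C := K * (Real.exp (μ * b) * a t))
      (fun u _ => (hd u).hasDerivWithinAt)
      (fun u hu => by
        have h1 := hder t ht (t - u) (by linarith [hu.2])
        rw [sub_sub_cancel] at h1
        exact h1.trans (mul_le_mul_of_nonneg_left (hmono _ (by linarith [hu.1]))
          (by positivity)))
      (x := t - b) (y := t - b') ⟨le_rfl, by linarith⟩ ⟨by linarith, le_rfl⟩
    rw [Real.norm_eq_abs, Real.norm_eq_abs, show t - b' - (t - b) = b - b' by ring,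
      abs_of_nonneg (sub_nonneg.2 hbb')] at this
    linarith

end IsExpSeq

/-! ### Uniform relative convergence of the jump densities -/

namespace IsExpSeq

variable {Ω : Type*} [MeasurableSpace Ω] {P : Measure Ω} {r : ℕ → ℝ} {Y : ℕ → Ω → ℝ}

lemma tendsto_integral_exp_mul_min (h : IsExpSeq P r Y) [IsProbabilityMeasure P] {μ C : ℝ}
    (hμ0 : 0 ≤ μ) (hμ : ∀ i, μ < r i) (hC : 0 ≤ C) :
    Tendsto (fun m => ∫ ω, Real.exp (μ * total Y ω) * min 1 (C * (total Y ω - arrival Y m ω)) ∂P)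
      atTop (𝓝 0) := by
  have hT := h.measurable_total
  have hA := h.measurable_arrival
  rw [← integral_zero Ω ℝ (μ := P)]
  refine tendsto_integral_of_dominated_convergence (fun ω => Real.exp (μ * total Y ω))
    (fun m => by fun_prop) (h.integrable_exp_mul_total hμ0 hμ) (fun m => ae_of_all _ fun ω => ?_)
    (ae_of_all _ fun ω => ?_)
  · have := mul_nonneg hC (sub_nonneg.2 (h.arrival_le_total m ω))
    rw [Real.norm_of_nonneg (by positivity)]
    exact mul_le_of_le_one_right (Real.exp_nonneg _) (min_le_left _ _)
  · have hc : Continuous fun x => Real.exp (μ * total Y ω) * min 1 (C * (total Y ω - x)) := by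
      fun_prop
    simpa [Function.comp_def] using (hc.tendsto _).comp (h.tendsto_arrival ω)

lemma abs_jumpDensity_sub_totalDensity_le [IsProbabilityMeasure P] (h : IsExpSeq P r Y) (n : ℕ)
    (hμ : ∀ k, n + 2 < k → r (n + 2) < r k) {t₀ : ℝ} (ht₀ : 0 < t₀) :
    ∃ ε : ℕ → ℝ, Tendsto ε atTop (𝓝 0) ∧ ∀ m t, t₀ ≤ t →
      |jumpDensity P r Y (n + 2 + m) t - totalDensity P r Y t| ≤
        jumpDensity P r Y (n + 2) t * ε m := by
  obtain ⟨C, hC, hb⟩ := h.exists_jumpDensity_sub_sub_le n ht₀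
  have hs := h.shift (n + 3)
  have hT := hs.measurable_total
  have hA := hs.measurable_arrival
  have hμ' : ∀ i, r (n + 2) < r (i + (n + 3)) := fun i => hμ _ (by omega)
  refine ⟨_, hs.tendsto_integral_exp_mul_min (h.rate_pos (n + 2)).le hμ' hC, fun m t ht => ?_⟩
  have hi : ∀ D : Ω → ℝ, Measurable D →
      Integrable (fun ω => jumpDensity P r Y (n + 1 + 1) (t - D ω)) P := fun D hD => by
    have := h.measurable_jumpDensity (n + 1 + 1)
    refine Integrable.of_bound (C := r (n + 1 + 1))
      (this.comp (by fun_prop)).aestronglyMeasurable (ae_of_all _ fun ω => ?_)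
    rw [Real.norm_of_nonneg (h.jumpDensity_nonneg _ _)]
    exact h.jumpDensity_le _ _
  rw [h.totalDensity_eq (n + 1), show n + 2 + m = n + 1 + 1 + m by omega, h.jumpDensity_add,
    ← integral_sub (hi _ (hA m)) (hi _ hT), ← integral_const_mul]
  have hexp := hs.integrable_exp_mul_total (h.rate_pos (n + 2)).le hμ'
  have hmin0 : ∀ ω, 0 ≤ min 1 (C * (total (fun i => Y (i + (n + 3))) ω -
      arrival (fun i => Y (i + (n + 3))) m ω)) := fun ω => by
    have := mul_nonneg hC (sub_nonneg.2 (hs.arrival_le_total m ω))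
    positivity
  have hA' := hA m
  have hint : Integrable (fun ω => Real.exp (r (n + 2) * total (fun i => Y (i + (n + 3))) ω) *
      min 1 (C * (total (fun i => Y (i + (n + 3))) ω -
        arrival (fun i => Y (i + (n + 3))) m ω))) P := by
    refine hexp.mono' (by fun_prop) (ae_of_all _ fun ω => ?_)
    rw [Real.norm_of_nonneg (mul_nonneg (Real.exp_nonneg _) (hmin0 ω))]
    exact mul_le_of_le_one_right (Real.exp_nonneg _) (min_le_left _ _)
  rw [← Real.norm_eq_abs]
  refine norm_integral_le_of_norm_le (hint.const_mul _) (ae_of_all _ fun ω => ?_)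
  exact hb t ht _ _ (hs.arrival_nonneg m ω) (hs.arrival_le_total m ω)

/-- The remainders decrease to `0` pointwise, so the events increase to the whole space and one of
them is not null. -/
lemma exists_measureReal_total_le_pos [IsProbabilityMeasure P] (h : IsExpSeq P r Y) {δ : ℝ}
    (hδ : 0 < δ) :
    ∃ m, ∀ n, m ≤ n → 0 < P.real {ω | total (fun i => Y (i + n)) ω ≤ δ} := by
  have hU : ⋃ n, {ω | total (fun i => Y (i + n)) ω ≤ δ} = Set.univ := by
    refine Set.eq_univ_of_forall fun ω => ?_
    have ht := (h.tendsto_arrival ω).eventually (lt_mem_nhds (sub_lt_self (total Y ω) hδ))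
    obtain ⟨n, hn⟩ := ht.exists
    refine Set.mem_iUnion.2 ⟨n, ?_⟩
    have := h.total_eq n ω
    simp only [Set.mem_ofPred_eq]
    linarith
  have hex : ∃ m, P {ω | total (fun i => Y (i + m)) ω ≤ δ} ≠ 0 := by
    by_contra! hcon
    have := measure_iUnion_null hcon
    rw [hU] at this
    simp at this
  obtain ⟨m, hm⟩ := hex
  refine ⟨m, fun n hn => ENNReal.toReal_pos_iff.2
    ⟨(pos_iff_ne_zero.2 hm).trans_le (measure_mono fun ω hω => ?_), measure_lt_top _ _⟩⟩
  have h1 := h.total_eq m ω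
  have h2 := h.total_eq n ω
  have h3 := h.arrival_mono ω hn
  simp only [Set.mem_ofPred_eq] at hω h3 ⊢
  linarith

/-- Keep only the event that the remainder is at most `t₀ / 2`. There the argument of the jump
density stays in `[t₀/2, t]`, and the growth bound compares its value with the one at `t`. -/
lemma exists_le_totalDensity [IsProbabilityMeasure P] (h : IsExpSeq P r Y) (n : ℕ) {t₀ : ℝ}
    (ht₀ : 0 < t₀) (hpos : 0 < P.real {ω | total (fun i => Y (i + (n + 3))) ω ≤ t₀ / 2}) :
    ∃ c, 0 < c ∧ ∀ t, t₀ ≤ t → c * jumpDensity P r Y (n + 2) t ≤ totalDensity P r Y t := by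
  obtain ⟨C, hC, hg⟩ := h.exists_growth_bound (n + 2) (half_pos ht₀)
  have hs := h.shift (n + 3)
  have hT := hs.measurable_total
  refine ⟨P.real {ω | total (fun i => Y (i + (n + 3))) ω ≤ t₀ / 2} *
    Real.exp (-(C * (t₀ / 2))), by positivity, fun t ht => ?_⟩
  have hm := h.measurable_jumpDensity (n + 2)
  have hi : Integrable (fun ω => jumpDensity P r Y (n + 2)
      (t - total (fun i => Y (i + (n + 3))) ω)) P := by
    refine Integrable.of_bound (C := r (n + 2))
      (hm.comp (by fun_prop)).aestronglyMeasurable (ae_of_all _ fun ω => ?_)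
    rw [Real.norm_of_nonneg (h.jumpDensity_nonneg _ _)]
    exact h.jumpDensity_le _ _
  have hms : MeasurableSet {ω | total (fun i => Y (i + (n + 3))) ω ≤ t₀ / 2} :=
    measurableSet_le hT measurable_const
  rw [h.totalDensity_eq (n + 1), mul_assoc]
  calc _ = ∫ ω in {ω | total (fun i => Y (i + (n + 3))) ω ≤ t₀ / 2},
        Real.exp (-(C * (t₀ / 2))) * jumpDensity P r Y (n + 2) t ∂P := by
          rw [setIntegral_const, smul_eq_mul]
    _ ≤ ∫ ω in {ω | total (fun i => Y (i + (n + 3))) ω ≤ t₀ / 2}, jumpDensity P r Y (n + 2)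
      (t - total (fun i => Y (i + (n + 3))) ω) ∂P := by
          refine setIntegral_mono_on (integrable_const _).integrableOn hi.integrableOn hms
            fun ω hω => ?_
          have hω' : total (fun i => Y (i + (n + 3))) ω ≤ t₀ / 2 := hω
          have h0 := hs.total_nonneg ω
          have h1 := hg (t - total (fun i => Y (i + (n + 3))) ω) t (by linarith) (by linarith)
          have h2 := h.jumpDensity_nonneg (n + 2) (t - total (fun i => Y (i + (n + 3))) ω)
          rw [sub_sub_cancel] at h1
          calc _ ≤ Real.exp (-(C * (t₀ / 2))) * (Real.exp (C * (t₀ / 2)) * jumpDensity P r Y (n + 2)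
                  (t - total (fun i => Y (i + (n + 3))) ω)) := by
                refine mul_le_mul_of_nonneg_left (h1.trans ?_) (Real.exp_nonneg _)
                gcongr
            _ = _ := by rw [← mul_assoc, ← Real.exp_add]; simp
    _ ≤ _ := setIntegral_le_integral hi (ae_of_all _ fun ω => h.jumpDensity_nonneg _ _)

lemma totalDensity_pos [IsProbabilityMeasure P] (h : IsExpSeq P r Y) {t : ℝ} (ht : 0 < t) :
    0 < totalDensity P r Y t := by
  obtain ⟨m, hm⟩ := h.exists_measureReal_total_le_pos (half_pos ht)
  obtain ⟨c, hc, hle⟩ := h.exists_le_totalDensity m ht (hm _ (by omega))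
  exact (mul_pos hc (h.jumpDensity_pos (m + 2) ht)).trans_le (hle t le_rfl)

lemma eventually_abs_jumpDensity_sub_le [IsProbabilityMeasure P] (h : IsExpSeq P r Y) {t₀ : ℝ}
    (ht₀ : 0 < t₀) {ε : ℝ} (hε : 0 < ε) :
    ∀ᶠ n in atTop, ∀ t, t₀ ≤ t →
      |jumpDensity P r Y n t - totalDensity P r Y t| ≤ ε * totalDensity P r Y t := by
  obtain ⟨m, hm⟩ := h.exists_measureReal_total_le_pos (half_pos ht₀)
  -- The index must meet two demands: a remainder small with positive probability, and a rate
  -- strictly below all later ones.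
  obtain ⟨n, hn, hrate⟩ := h.exists_rate_lt (m + 2)
  obtain ⟨n, rfl⟩ : ∃ k, n = k + 2 := ⟨n - 2, by omega⟩
  obtain ⟨c, hc, hle⟩ := h.exists_le_totalDensity n ht₀ (hm _ (by omega))
  obtain ⟨δ, hδ, hb⟩ := h.abs_jumpDensity_sub_totalDensity_le n hrate ht₀
  rw [← map_add_atTop_eq_nat (n + 2), eventually_map]
  filter_upwards [hδ.eventually (gt_mem_nhds (mul_pos hε hc))] with k hk t ht
  rw [add_comm k]
  calc _ ≤ jumpDensity P r Y (n + 2) t * δ k := hb k t ht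
    _ ≤ jumpDensity P r Y (n + 2) t * (ε * c) := by
      have := h.jumpDensity_nonneg (n + 2) t
      gcongr
    _ = ε * (c * jumpDensity P r Y (n + 2) t) := by ring
    _ ≤ _ := by gcongr; exact hle t ht

end IsExpSeq

/-! ### Passing to a version that is measurable, nonnegative and summable everywhere -/

lemma exists_isExpSeq {Ω : Type*} [MeasurableSpace Ω] {P : Measure Ω}
    {r : ℕ → ℝ} {X : ℕ → Ω → ℝ} (hr : ∀ n, 0 < r n) (hs : Summable fun n => 1 / r n)
    (hX : iIndepFun X P) (hl : ∀ n, HasLaw (X n) (expMeasure (r n)) P) :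
    ∃ Y, IsExpSeq P r Y ∧ ∀ᵐ ω ∂P, ∀ n, X n ω = Y n ω := by
  have hm : ∀ n, AEMeasurable (X n) P := fun n => (hl n).aemeasurable
  have h0 : ∀ᵐ ω ∂P, ∀ n, 0 ≤ X n ω := by
    refine ae_all_iff.2 fun n => ?_
    refine ((hl n).ae_iff (p := fun x => 0 ≤ x) (measurableSet_setOfPred.1 measurableSet_Ici)).2 ?_
    rw [ae_iff]
    simp only [not_le]
    exact expMeasure_Iio_zero (r n)
  have hsum : ∀ᵐ ω ∂P, ∑' n, ENNReal.ofReal (X n ω) < ⊤ := by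
    refine ae_lt_top' (by fun_prop) ?_
    rw [lintegral_tsum (fun n => (hm n).ennreal_ofReal)]
    have hb : ∀ n, ∫⁻ ω, ENNReal.ofReal (X n ω) ∂P ≤ ENNReal.ofReal (4 * (1 / r n)) := fun n => by
      rw [(hl n).lintegral_comp (f := ENNReal.ofReal) (by fun_prop), mul_one_div]
      exact lintegral_ofReal_expMeasure_le (hr n)
    refine ne_top_of_le_ne_top ?_ (ENNReal.tsum_le_tsum hb)
    exact (hs.mul_left 4).tsum_ofReal_ne_top
  have hgood : ∀ᵐ ω ∂P, ∀ n, X n ω = (hm n).mk (X n) ω :=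
    ae_all_iff.2 fun n => (hm n).ae_eq_mk
  have hall : ∀ᵐ ω ∂P, (∀ n, X n ω = (hm n).mk (X n) ω) ∧ (∀ n, 0 ≤ X n ω) ∧
      ∑' n, ENNReal.ofReal (X n ω) < ⊤ := hgood.and (h0.and hsum)
  -- A measurable null set holding all exceptions; the version is `0` on it.
  obtain ⟨N, hN, hNm, hN0⟩ := exists_measurable_superset_of_null (ae_iff.1 hall)
  have hmem : ∀ ω, ω ∉ N → (∀ n, X n ω = (hm n).mk (X n) ω) ∧ (∀ n, 0 ≤ X n ω) ∧
      ∑' n, ENNReal.ofReal (X n ω) < ⊤ := fun ω hω => by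
    by_contra hcon
    exact hω (hN hcon)
  have hae : ∀ᵐ ω ∂P, ∀ n, X n ω = Nᶜ.indicator ((hm n).mk (X n)) ω := by
    filter_upwards [measure_eq_zero_iff_ae_notMem.1 hN0] with ω hω n
    rw [Set.indicator_of_mem (by exact hω), (hmem ω hω).1 n]
  have hae' : ∀ n, X n =ᵐ[P] Nᶜ.indicator ((hm n).mk (X n)) := fun n => by
    filter_upwards [hae] with ω hω using hω n
  refine ⟨fun n => Nᶜ.indicator ((hm n).mk (X n)), ?_, hae⟩
  refine ⟨fun n => (hm n).measurable_mk.indicator hNm.compl, fun n ω => ?_, fun ω => ?_,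
    hX.congr hae', fun n => (hl n).congr (hae' n).symm, hr, hs⟩
  · by_cases hω : ω ∈ N
    · simp [hω]
    · rw [Set.indicator_of_mem (by exact hω), ← (hmem ω hω).1 n]
      exact (hmem ω hω).2.1 n
  · by_cases hω : ω ∈ N
    · simp [hω]
    · have h1 := ENNReal.summable_toReal (hmem ω hω).2.2.ne
      refine h1.congr fun n => ?_
      rw [Set.indicator_of_mem (by exact hω), ← (hmem ω hω).1 n,
        ENNReal.toReal_ofReal ((hmem ω hω).2.1 n)]

/-! ### Reindexing and the pathwise description of the birth process -/

/-- The positive natural number `n₀ + j`. -/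
def PNat.addNat (n₀ : ℕ+) (j : ℕ) : ℕ+ := ⟨n₀ + j, Nat.add_pos_left n₀.pos j⟩

lemma PNat.addNat_injective (n₀ : ℕ+) : Function.Injective n₀.addNat := fun i j h => by
  have := congrArg PNat.val h
  simpa [PNat.addNat] using this

lemma PNat.exists_eq_addNat {n₀ k : ℕ+} (h : n₀ ≤ k) : ∃ j, k = n₀.addNat j :=
  ⟨k - n₀, PNat.eq (Nat.add_sub_of_le (PNat.coe_le_coe _ _ |>.2 h)).symm⟩

lemma PNat.addNat_lt_addNat {n₀ : ℕ+} {i j : ℕ} : n₀.addNat i < n₀.addNat j ↔ i < j := by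
  rw [← PNat.coe_lt_coe]
  simp [PNat.addNat]

lemma PNat.le_addNat (n₀ : ℕ+) (j : ℕ) : n₀ ≤ n₀.addNat j := by
  rw [← PNat.coe_le_coe]
  simp [PNat.addNat]

section Birth

variable {Ω : Type*} {τ : ℕ+ → Ω → ℝ} {n₀ : ℕ+} {t : ℝ} {ω : Ω}

lemma passageTime_addNat (j : ℕ) :
    passageTime τ n₀ (n₀.addNat j) ω = arrival (fun i => τ (n₀.addNat i)) (j + 1) ω := by
  rw [passageTime, arrival]
  symm
  refine Finset.sum_bij (fun i _ => n₀.addNat i) (fun i hi => ?_)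
    (fun i _ j _ h => n₀.addNat_injective h) (fun k hk => ?_) fun _ _ => rfl
  · rw [Finset.mem_Icc]
    refine ⟨n₀.le_addNat i, not_lt.1 fun h => ?_⟩
    have := PNat.addNat_lt_addNat.1 h
    have := Finset.mem_range.1 hi
    omega
  · rw [Finset.mem_Icc] at hk
    obtain ⟨i, rfl⟩ := PNat.exists_eq_addNat hk.1
    refine ⟨i, Finset.mem_range.2 (Nat.lt_succ_of_le (not_lt.1 fun h => ?_)), rfl⟩
    exact absurd hk.2 (not_le.2 (PNat.addNat_lt_addNat.2 h))

lemma passageTime_of_lt {k : ℕ+} (h : k < n₀) : passageTime τ n₀ k ω = 0 := by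
  rw [passageTime, Finset.Icc_eq_empty (not_le.2 h), Finset.sum_empty]

lemma birthProcess_eq_coe_iff {x : ℕ+} : birthProcess τ n₀ t ω = x ↔
    t < passageTime τ n₀ x ω ∧ ∀ k < x, passageTime τ n₀ k ω ≤ t := by
  classical
  unfold birthProcess
  split_ifs with h
  · rw [WithTop.coe_inj]
    simp only [← not_lt]
    convert PNat.find_eq_iff h
  · simp only [WithTop.top_ne_coe, false_iff, not_and]
    exact fun h' => absurd ⟨x, h'⟩ h

lemma birthProcess_eq_top_iff : birthProcess τ n₀ t ω = ⊤ ↔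
    ∀ k, passageTime τ n₀ k ω ≤ t := by
  unfold birthProcess
  split_ifs with h
  · simp only [WithTop.coe_ne_top, false_iff, not_forall, not_le]
    exact h
  · simpa using h

lemma birthProcess_eq_addNat_iff (ht : 0 ≤ t)
    (hmono : Monotone fun n => arrival (fun i => τ (n₀.addNat i)) n ω) (j : ℕ) :
    birthProcess τ n₀ t ω = (n₀.addNat j : ℕ+) ↔
      arrival (fun i => τ (n₀.addNat i)) j ω ≤ t ∧
        t < arrival (fun i => τ (n₀.addNat i)) (j + 1) ω := by
  rw [birthProcess_eq_coe_iff, passageTime_addNat, and_comm]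
  refine and_congr_left fun _ => ⟨fun h => ?_, fun h k hk => ?_⟩
  · cases j with
    | zero => simpa [arrival] using ht
    | succ i =>
      rw [← passageTime_addNat]
      exact h _ (PNat.addNat_lt_addNat.2 i.lt_succ_self)
  · rcases lt_or_ge k n₀ with hk' | hk'
    · rwa [passageTime_of_lt hk']
    · obtain ⟨i, rfl⟩ := PNat.exists_eq_addNat hk'
      rw [passageTime_addNat]
      exact (hmono (PNat.addNat_lt_addNat.1 hk)).trans h

lemma explosionTime_eq (τ : ℕ+ → Ω → ℝ) (n₀ : ℕ+) (ω : Ω) :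
    explosionTime τ n₀ ω = ∑' j, ENNReal.ofReal (τ (n₀.addNat j) ω) := by
  let e : ℕ ≃ Set.Ici n₀ := Equiv.ofBijective (fun j => ⟨n₀.addNat j, n₀.le_addNat j⟩)
    ⟨fun i j h => n₀.addNat_injective (congrArg Subtype.val h), fun k => by
      obtain ⟨j, hj⟩ := PNat.exists_eq_addNat k.2
      exact ⟨j, Subtype.ext hj.symm⟩⟩
  exact (e.tsum_eq fun k : Set.Ici n₀ => ENNReal.ofReal (τ k ω)).symm

lemma explosionTime_eq_ofReal_total (h0 : ∀ j, 0 ≤ τ (n₀.addNat j) ω)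
    (hs : Summable fun j => τ (n₀.addNat j) ω) :
    explosionTime τ n₀ ω = ENNReal.ofReal (total (fun j => τ (n₀.addNat j)) ω) := by
  rw [explosionTime_eq, total, ENNReal.ofReal_tsum_of_nonneg h0 hs]

end Birth

lemma arrival_congr {Ω : Type*} {X Y : ℕ → Ω → ℝ} {ω : Ω} (h : ∀ n, X n ω = Y n ω) (n : ℕ) :
    arrival X n ω = arrival Y n ω :=
  Finset.sum_congr rfl fun i _ => h i

lemma total_congr {Ω : Type*} {X Y : ℕ → Ω → ℝ} {ω : Ω} (h : ∀ n, X n ω = Y n ω) :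
    total X ω = total Y ω :=
  tsum_congr h

/-! ### From sequences of sojourn times back to the birth process -/

section Transfer

variable {Ω : Type*} [MeasurableSpace Ω] {P : Measure Ω} {F : ℕ+ → ℝ}
  {τ : ℕ+ → Ω → ℝ} {n₀ : ℕ+} {Y : ℕ → Ω → ℝ}

lemma ae_explosionTime_eq (hY : IsExpSeq P (fun j => F (n₀.addNat j)) Y)
    (hae : ∀ᵐ ω ∂P, ∀ j, τ (n₀.addNat j) ω = Y j ω) :
    ∀ᵐ ω ∂P, explosionTime τ n₀ ω = ENNReal.ofReal (total Y ω) := by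
  filter_upwards [hae] with ω hω
  rw [← total_congr hω]
  exact explosionTime_eq_ofReal_total (fun j => hω j ▸ hY.nonneg j ω)
    ((hY.summable ω).congr fun j => (hω j).symm)

lemma ae_birthProcess_eq_addNat_iff (hY : IsExpSeq P (fun j => F (n₀.addNat j)) Y)
    (hae : ∀ᵐ ω ∂P, ∀ j, τ (n₀.addNat j) ω = Y j ω) {t : ℝ} (ht : 0 ≤ t) :
    ∀ᵐ ω ∂P, ∀ j, birthProcess τ n₀ t ω = (n₀.addNat j : ℕ+) ↔
      arrival Y j ω ≤ t ∧ t < arrival Y (j + 1) ω := by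
  filter_upwards [hae] with ω hω j
  rw [← arrival_congr hω, ← arrival_congr hω]
  refine birthProcess_eq_addNat_iff ht (fun m n hmn => ?_) j
  simp only [arrival_congr hω]
  exact hY.arrival_mono ω hmn

lemma nullMeasurableSet_birthProcess (hY : IsExpSeq P (fun j => F (n₀.addNat j)) Y)
    (hae : ∀ᵐ ω ∂P, ∀ j, τ (n₀.addNat j) ω = Y j ω) {t : ℝ} (ht : 0 ≤ t) (x : ℕ+) :
    NullMeasurableSet {ω | birthProcess τ n₀ t ω = (x : WithTop ℕ+)} P := by
  rcases lt_or_ge x n₀ with hx | hx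
  · convert nullMeasurableSet_empty
    ext ω
    simp [birthProcess_eq_coe_iff, passageTime_of_lt hx, ht]
  · obtain ⟨j, rfl⟩ := PNat.exists_eq_addNat hx
    have hm : MeasurableSet {ω | arrival Y j ω ≤ t ∧ t < arrival Y (j + 1) ω} :=
      (measurableSet_le (hY.measurable_arrival _) measurable_const).inter
        (measurableSet_lt measurable_const (hY.measurable_arrival _))
    refine hm.nullMeasurableSet.congr (eventuallyEq_set.2 ?_)
    filter_upwards [ae_birthProcess_eq_addNat_iff hY hae ht] with ω hω using (hω j).symm

lemma measureReal_birthProcess_eq (hY : IsExpSeq P (fun j => F (n₀.addNat j)) Y)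
    (hae : ∀ᵐ ω ∂P, ∀ j, τ (n₀.addNat j) ω = Y j ω) {t : ℝ} (ht : 0 ≤ t) (j : ℕ) :
    P.real {ω | birthProcess τ n₀ t ω = (n₀.addNat j : ℕ+)} =
      jumpDensity P (fun j => F (n₀.addNat j)) Y j t / F (n₀.addNat j) := by
  have hF : F (n₀.addNat j) ≠ 0 := (hY.rate_pos j).ne'
  rw [jumpDensity, mul_div_cancel_left₀ _ hF]
  refine measureReal_congr (eventuallyEq_set.2 ?_)
  filter_upwards [ae_birthProcess_eq_addNat_iff hY hae ht] with ω hω using hω j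

/-- The uniform asymptotics of the one-dimensional distributions of the birth process. -/
lemma eventually_abs_measureReal_birthProcess_sub_le [IsProbabilityMeasure P]
    (hY : IsExpSeq P (fun j => F (n₀.addNat j)) Y)
    (hae : ∀ᵐ ω ∂P, ∀ j, τ (n₀.addNat j) ω = Y j ω) {t₀ : ℝ} (ht₀ : 0 < t₀) {ε : ℝ}
    (hε : 0 < ε) :
    ∀ᶠ x : ℕ+ in atTop, ∀ t, t₀ ≤ t →
      |P.real {ω | birthProcess τ n₀ t ω = (x : WithTop ℕ+)} -
        totalDensity P (fun j => F (n₀.addNat j)) Y t / F x| ≤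
      ε * (totalDensity P (fun j => F (n₀.addNat j)) Y t / F x) := by
  obtain ⟨m, hm⟩ := eventually_atTop.1 (hY.eventually_abs_jumpDensity_sub_le ht₀ hε)
  filter_upwards [eventually_ge_atTop (n₀.addNat m)] with x hx t ht
  obtain ⟨j, rfl⟩ := PNat.exists_eq_addNat ((n₀.le_addNat m).trans hx)
  have hj : m ≤ j := not_lt.1 fun h => absurd hx (not_le.2 (PNat.addNat_lt_addNat.2 h))
  rw [measureReal_birthProcess_eq hY hae (ht₀.le.trans ht), ← sub_div, abs_div,
    abs_of_pos (hY.rate_pos j), ← mul_div_assoc]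
  have := hm j hj t ht
  have hF := hY.rate_pos j
  gcongr

lemma nonExplosion_ae_eq (hY : IsExpSeq P (fun j => F (n₀.addNat j)) Y)
    (hae : ∀ᵐ ω ∂P, ∀ j, τ (n₀.addNat j) ω = Y j ω) {t : ℝ} (ht : 0 ≤ t) :
    nonExplosion τ n₀ t =ᵐ[P] {ω | t < total Y ω} := by
  refine eventuallyEq_set.2 ?_
  filter_upwards [ae_explosionTime_eq hY hae] with ω hω
  simp only [nonExplosion, Set.mem_ofPred_eq, hω]
  exact ENNReal.ofReal_lt_ofReal_iff_of_nonneg ht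

lemma isContinuousDensity_totalDensity [IsProbabilityMeasure P]
    (hY : IsExpSeq P (fun j => F (n₀.addNat j)) Y)
    (hae : ∀ᵐ ω ∂P, ∀ j, τ (n₀.addNat j) ω = Y j ω) :
    IsContinuousDensity (explosionTime τ n₀) P
      (totalDensity P (fun j => F (n₀.addNat j)) Y) where
  continuous := hY.continuous_totalDensity
  nonneg := hY.totalDensity_nonneg
  ae_ne_top := by
    filter_upwards [ae_explosionTime_eq hY hae] with ω hω
    rw [hω]
    exact ENNReal.ofReal_ne_top
  hasLaw := hY.hasLaw_total.congr <| by
    filter_upwards [ae_explosionTime_eq hY hae] with ω hω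
    rw [hω, ENNReal.toReal_ofReal (hY.total_nonneg ω)]

lemma measureReal_nonExplosion_pos [IsProbabilityMeasure P]
    (hY : IsExpSeq P (fun j => F (n₀.addNat j)) Y)
    (hae : ∀ᵐ ω ∂P, ∀ j, τ (n₀.addNat j) ω = Y j ω) {t : ℝ} (ht : 0 < t) :
    0 < P.real (nonExplosion τ n₀ t) := by
  have hc := hY.continuous_totalDensity
  have hi := integrable_of_hasLaw_withDensity hc.measurable hY.totalDensity_nonneg hY.hasLaw_total
  have he : P.real {ω | t < total Y ω} =
      ∫ s in Set.Ioi t, totalDensity P (fun j => F (n₀.addNat j)) Y s :=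
    measureReal_preimage_of_hasLaw_withDensity hc.measurable hY.totalDensity_nonneg
      hY.hasLaw_total (measurableSet_Ioi (a := t))
  rw [measureReal_congr (nonExplosion_ae_eq hY hae ht.le), he,
    setIntegral_pos_iff_support_of_nonneg_ae (ae_of_all _ hY.totalDensity_nonneg) hi.integrableOn]
  have hsub : Set.Ioi t ⊆ Function.support (totalDensity P (fun j => F (n₀.addNat j)) Y) :=
    fun s hs => (hY.totalDensity_pos (ht.trans hs)).ne'
  rw [Set.inter_eq_self_of_subset_right hsub]
  simp

lemma hasDerivAt_measureReal_nonExplosion [IsProbabilityMeasure P]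
    (hY : IsExpSeq P (fun j => F (n₀.addNat j)) Y)
    (hae : ∀ᵐ ω ∂P, ∀ j, τ (n₀.addNat j) ω = Y j ω) {t : ℝ} (ht : 0 < t) :
    HasDerivAt (fun s => P.real (nonExplosion τ n₀ s))
      (-totalDensity P (fun j => F (n₀.addNat j)) Y t) t := by
  have hc := hY.continuous_totalDensity
  have hd := (hasDerivAt_cdf_of_hasLaw_withDensity hc.measurable hY.totalDensity_nonneg
    hY.hasLaw_total hc.continuousAt (t := t)).const_sub 1
  refine hd.congr_of_eventuallyEq ?_
  filter_upwards [lt_mem_nhds ht] with s hs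
  rw [measureReal_congr (nonExplosion_ae_eq hY hae (le_of_lt hs)),
    ← probReal_compl_eq_one_sub (measurableSet_le hY.measurable_total measurable_const)]
  congr 1
  ext ω
  simp

/-- The value `⊤` also lies above `x`, and intersecting with `T > t` removes it: there some partial
sum exceeds `t`. Conversely, a finite state gives `t <` a partial sum `≤ T`. -/
lemma ae_nonExplosion_inter_lt_birthProcess (hY : IsExpSeq P (fun j => F (n₀.addNat j)) Y)
    (hae : ∀ᵐ ω ∂P, ∀ j, τ (n₀.addNat j) ω = Y j ω) {t : ℝ} (ht : 0 ≤ t) (x : ℕ+) :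
    (nonExplosion τ n₀ t ∩ {ω | (x : WithTop ℕ+) < birthProcess τ n₀ t ω} : Set Ω) =ᵐ[P]
      ⋃ k : Set.Ioi x, {ω | birthProcess τ n₀ t ω = ((k : ℕ+) : WithTop ℕ+)} := by
  refine eventuallyEq_set.2 ?_
  filter_upwards [hae, ae_explosionTime_eq hY hae] with ω hω hT
  have hpass : ∀ j, passageTime τ n₀ (n₀.addNat j) ω = arrival Y (j + 1) ω := fun j => by
    rw [passageTime_addNat, arrival_congr hω]
  have hne : ω ∈ nonExplosion τ n₀ t ↔ t < total Y ω := by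
    simp only [nonExplosion, Set.mem_ofPred_eq, hT]
    exact ENNReal.ofReal_lt_ofReal_iff_of_nonneg ht
  simp only [Set.mem_inter_iff, hne, Set.mem_iUnion, Set.mem_ofPred_eq]
  constructor
  · rintro ⟨h1, h2⟩
    cases hb : birthProcess τ n₀ t ω with
    | top =>
      obtain ⟨j, hj⟩ := ((hY.tendsto_arrival ω).eventually (lt_mem_nhds h1)).exists
      have h3 := birthProcess_eq_top_iff.1 hb (n₀.addNat j)
      rw [hpass] at h3
      have h4 := hY.arrival_mono ω j.le_succ
      simp only at h4
      linarith
    | coe k =>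
      rw [hb, WithTop.coe_lt_coe] at h2
      exact ⟨⟨k, h2⟩, rfl⟩
  · rintro ⟨⟨k, hk⟩, hb⟩
    refine ⟨?_, by rw [hb, WithTop.coe_lt_coe]; exact hk⟩
    have h1 := (birthProcess_eq_coe_iff.1 hb).1
    rcases lt_or_ge k n₀ with hk' | hk'
    · rw [passageTime_of_lt hk'] at h1
      linarith
    · obtain ⟨j, rfl⟩ := PNat.exists_eq_addNat hk'
      rw [hpass] at h1
      exact h1.trans_le (hY.arrival_le_total _ ω)

lemma hasSum_measureReal_birthProcess [IsProbabilityMeasure P]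
    (hY : IsExpSeq P (fun j => F (n₀.addNat j)) Y)
    (hae : ∀ᵐ ω ∂P, ∀ j, τ (n₀.addNat j) ω = Y j ω) {t : ℝ} (ht : 0 ≤ t) (x : ℕ+) :
    HasSum (fun k : Set.Ioi x => P.real {ω | birthProcess τ n₀ t ω = ((k : ℕ+) : WithTop ℕ+)})
      (P.real (nonExplosion τ n₀ t ∩ {ω | (x : WithTop ℕ+) < birthProcess τ n₀ t ω})) := by
  have hd : Pairwise (Function.onFun (AEDisjoint P) fun k : Set.Ioi x =>
      {ω | birthProcess τ n₀ t ω = ((k : ℕ+) : WithTop ℕ+)}) := fun i j hij =>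
    Disjoint.aedisjoint <| Set.disjoint_left.2 fun ω hi hj => hij <| Subtype.ext <|
      WithTop.coe_injective ((Eq.symm hi).trans hj)
  have hU := measure_iUnion₀ hd fun k => nullMeasurableSet_birthProcess hY hae ht k
  rw [measureReal_congr (ae_nonExplosion_inter_lt_birthProcess hY hae ht x), measureReal_def, hU]
  simp only [measureReal_def]
  rw [ENNReal.tsum_toReal_eq fun _ => measure_ne_top _ _]
  exact (ENNReal.summable_toReal (hU ▸ measure_ne_top _ _)).hasSum

lemma cond_measureReal_lt_birthProcess [IsProbabilityMeasure P]
    (hY : IsExpSeq P (fun j => F (n₀.addNat j)) Y)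
    (hae : ∀ᵐ ω ∂P, ∀ j, τ (n₀.addNat j) ω = Y j ω) {t : ℝ} (ht : 0 ≤ t) (x : ℕ+) :
    (P[|nonExplosion τ n₀ t]).real {ω | (x : WithTop ℕ+) < birthProcess τ n₀ t ω} =
      (P.real (nonExplosion τ n₀ t))⁻¹ *
        P.real (nonExplosion τ n₀ t ∩ {ω | (x : WithTop ℕ+) < birthProcess τ n₀ t ω}) := by
  have hn : NullMeasurableSet (nonExplosion τ n₀ t) P :=
    (measurableSet_lt measurable_const hY.measurable_total).nullMeasurableSet.congr
      (nonExplosion_ae_eq hY hae ht).symm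
  rw [measureReal_def, ProbabilityTheory.cond, Measure.smul_apply, Measure.restrict_apply₀' hn,
    smul_eq_mul, ENNReal.toReal_mul, ENNReal.toReal_inv, Set.inter_comm]
  rfl

/-- The asymptotics of the tail of the birth process before explosion. -/
lemma tendsto_measureReal_lt_birthProcess_div [IsProbabilityMeasure P] (hF : ∀ k, 0 < F k)
    (hs : Summable fun k : ℕ+ => 1 / F k)
    (hY : IsExpSeq P (fun j => F (n₀.addNat j)) Y)
    (hae : ∀ᵐ ω ∂P, ∀ j, τ (n₀.addNat j) ω = Y j ω) {t : ℝ} (ht : 0 < t) :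
    Tendsto (fun x : ℕ+ =>
      P.real (nonExplosion τ n₀ t ∩ {ω | (x : WithTop ℕ+) < birthProcess τ n₀ t ω}) /
        (totalDensity P (fun j => F (n₀.addNat j)) Y t * ∑' k : Set.Ioi x, 1 / F k))
      atTop (𝓝 1) := by
  set g := totalDensity P (fun j => F (n₀.addNat j)) Y t
  have hg : 0 < g := hY.totalDensity_pos ht
  refine Metric.tendsto_nhds.2 fun ε hε => ?_
  -- At the fixed time `t` one threshold `m` serves all later states, so the termwise bounds can be
  -- summed over `k > x`. Halving `ε` makes the final inequality strict.
  obtain ⟨m, hm⟩ := eventually_atTop.1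
    (eventually_abs_measureReal_birthProcess_sub_le hY hae ht (half_pos hε))
  filter_upwards [eventually_ge_atTop m] with x hx
  have hsx : Summable fun k : Set.Ioi x => 1 / F k := hs.subtype _
  have hpos : 0 < ∑' k : Set.Ioi x, 1 / F k :=
    hsx.tsum_pos (fun k => (one_div_pos.2 (hF k)).le) ⟨x + 1, PNat.lt_add_right x 1⟩
      (one_div_pos.2 (hF _))
  have hsum := hasSum_measureReal_birthProcess hY hae ht.le x
  have hgs := hsx.hasSum.mul_left g
  have hk : ∀ k : Set.Ioi x,
      |P.real {ω | birthProcess τ n₀ t ω = ((k : ℕ+) : WithTop ℕ+)} - g * (1 / F k)| ≤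
        ε / 2 * (g * (1 / F k)) := fun k => by
    rw [mul_one_div]
    exact hm k (hx.trans (le_of_lt k.2)) t le_rfl
  have hupper := hasSum_le (fun k => (abs_le.1 (hk k)).2) (hsum.sub hgs) (hgs.mul_left (ε / 2))
  have hlower := hasSum_le (fun k => (abs_le.1 (hk k)).1) (hgs.mul_left (ε / 2)).neg
    (hsum.sub hgs)
  have hgp : 0 < g * ∑' k : Set.Ioi x, 1 / F k := mul_pos hg hpos
  rw [Real.dist_eq, div_sub_one hgp.ne', abs_div, abs_of_pos hgp, div_lt_iff₀ hgp]
  refine (abs_le.2 ⟨hlower, hupper⟩).trans_lt ?_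
  gcongr
  linarith

end Transfer

theorem mainTheorem1 {Ω : Type*} [MeasurableSpace Ω] (P : Measure Ω) [IsProbabilityMeasure P]
    (F : ℕ+ → ℝ) (hF : ∀ k, 0 < F k) (hexpl : Summable fun k : ℕ+ => 1 / F k)
    (τ : ℕ+ → Ω → ℝ) (hindep : iIndepFun τ P) (hlaw : ∀ k, HasLaw (τ k) (expMeasure (F k)) P)
    (n₀ : ℕ+) :
    ∃ g : ℝ → ℝ, IsContinuousDensity (explosionTime τ n₀) P g ∧
      (∀ t : ℝ, 0 < t → 0 < g t) ∧
      (∀ t : ℝ, 0 < t →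
        Tendsto (fun x : ℕ+ => P.real {ω | birthProcess τ n₀ t ω = (x : WithTop ℕ+)} /
          (g t / F x)) atTop (𝓝 1)) ∧
      (∀ t₀ : ℝ, 0 < t₀ →
        TendstoUniformlyOn
          (fun (x : ℕ+) (t : ℝ) => P.real {ω | birthProcess τ n₀ t ω = (x : WithTop ℕ+)} /
            (g t / F x))
          (fun _ => 1) atTop (Set.Ioi t₀)) ∧
      (∀ t : ℝ, 0 < t →
        0 < P.real (nonExplosion τ n₀ t) ∧
        HasDerivAt (fun s : ℝ => Real.log (P.real (nonExplosion τ n₀ s)))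
          (-(g t / P.real (nonExplosion τ n₀ t))) t ∧
        Tendsto (fun x : ℕ+ =>
          (P[|nonExplosion τ n₀ t]).real {ω | (x : WithTop ℕ+) < birthProcess τ n₀ t ω} /
            (g t / P.real (nonExplosion τ n₀ t) * ∑' k : Set.Ioi x, 1 / F k)) atTop (𝓝 1)) := by
  obtain ⟨Y, hY, hae⟩ := exists_isExpSeq (P := P) (r := fun j => F (n₀.addNat j))
    (X := fun j => τ (n₀.addNat j)) (fun j => hF _) (hexpl.comp_injective n₀.addNat_injective)
    (hindep.precomp n₀.addNat_injective) (fun j => hlaw _)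
  have hunif : ∀ t₀ : ℝ, 0 < t₀ → TendstoUniformlyOn
      (fun (x : ℕ+) (t : ℝ) => P.real {ω | birthProcess τ n₀ t ω = (x : WithTop ℕ+)} /
        (totalDensity P (fun j => F (n₀.addNat j)) Y t / F x))
      (fun _ => 1) atTop (Set.Ioi t₀) := fun t₀ ht₀ => by
    refine Metric.tendstoUniformlyOn_iff.2 fun ε hε => ?_
    filter_upwards [eventually_abs_measureReal_birthProcess_sub_le hY hae ht₀ (half_pos hε)]
      with x hx t ht
    have hgp : 0 < totalDensity P (fun j => F (n₀.addNat j)) Y t / F x :=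
      div_pos (hY.totalDensity_pos (ht₀.trans ht)) (hF x)
    rw [dist_comm, Real.dist_eq, div_sub_one hgp.ne', abs_div, abs_of_pos hgp, div_lt_iff₀ hgp]
    refine (hx t (le_of_lt ht)).trans_lt ?_
    gcongr
    linarith
  refine ⟨totalDensity P (fun j => F (n₀.addNat j)) Y, isContinuousDensity_totalDensity hY hae,
    fun t ht => hY.totalDensity_pos ht,
    -- The pointwise limit at `t` is read off from uniform convergence on `(t / 2, ∞)`.
    fun t ht => (hunif (t / 2) (half_pos ht)).tendsto_at (half_lt_self ht), hunif,
    fun t ht => ?_⟩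
  have hpos := measureReal_nonExplosion_pos hY hae ht
  refine ⟨hpos, ?_, ?_⟩
  · rw [← neg_div]
    exact (hasDerivAt_measureReal_nonExplosion hY hae ht).log hpos.ne'
  · refine (tendsto_measureReal_lt_birthProcess_div hF hexpl hY hae ht).congr fun x => ?_
    rw [cond_measureReal_lt_birthProcess hY hae ht.le, div_mul_eq_mul_div, inv_mul_eq_div,
      div_div_div_cancel_right₀ hpos.ne']
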